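/- Let $D,K>0$, let $W_1$ be a zero-mean Gaussian random field on $[0,D]^2$ and $W_2$ a zero-mean Gaussian random field on $[0,K]^2$, defined on a common probability space and both with almost surely continuous paths. Write $z_1=D$, $z_2=K$. For $j=1,2$ let $q_j$ be the covariance function of $W_j$, let $Q_j\varphi=\int_{[0,z_j]^2}q_j(\cdot,y)\,\varphi(y)\,dy$ be its covariance operator on $L^2([0,z_j]^2)$, and let $(\lambda_i^{(j)},e_i^{(j)})_{i\ge 1}$ be eigenpairs of $Q_j$ such that $(e_i^{(j)})_{i\ge1}$ is an orthonormal basis of $L^2([0,z_j]^2)$. Assume that the $e_i^{(j)}$ are continuously differentiable on $[0,z_j]^2$ and that there are constants $\alpha,\beta,C_e,C_\lambda>0$ such that for all $i\ge1$ and $j=1,2$ $$\|e_i^{(j)}\|_{L^\infty([0,z_j]^2)}\le C_e,\qquad \|\nabla e_i^{(j)}\|_{L^\infty([0,z_j]^2)}\le C_e\, i^{\alpha},\qquad \sum_{i=1}^\infty\bigl(\lambda_i^{(1)}+\lambda_i^{(2)}\bigr)\,i^{\beta}\le C_\lambda .$$ For $\varepsilon_W>0$ and $j=1,2$ let $M_j\ge1$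 be an integer with $z_j/M_j\le\varepsilon_W$, and let $W_j^{(\varepsilon_W)}$ be the random field obtained by evaluating $W_j$ at the points $(k z_j/M_j,\ l z_j/M_j)$, $k,l=0,\dots,M_j$, of the equidistant grid on $[0,z_j]^2$ and interpolating bilinearly on each grid cell. Then for every $n\in[1,\infty)$ and every $\gamma$ with $0\le\gamma<\min(1,\beta/(2\alpha))$, $$\|W_1-W_1^{(\varepsilon_W)}\|_{L^n(\Omega;L^\infty([0,D]^2))}\le C(D,n)\,\varepsilon_W^{\gamma},\qquad \|W_2-W_2^{(\varepsilon_W)}\|_{L^n(\Omega;L^\infty([0,K]^2))}\le C(K,n)\,\varepsilon_W^{\gamma},$$ where $\|F\|_{L^n(\Omega;L^\infty)}=\mathbb E\bigl(\operatorname{ess\,sup}|F|^n\bigr)^{1/n}$ and, besides the indicated arguments, $C(\cdot,\cdot)$ depends only on $\alpha,\beta,C_e,C_\lambda$ and $\gamma$; in particular it does not depend on $\varepsilon_W$ or the grids. -/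

import Mathlib

open MeasureTheory ProbabilityTheory
open scoped ENNReal

noncomputable section

namespace GRF

/-- The Euclidean plane. -/
abbrev Plane : Type := EuclideanSpace ℝ (Fin 2)

/-- The closed square `[0, L]²`. -/
def square (L : ℝ) : Set Plane := {z | ∀ k, z k ∈ Set.Icc (0 : ℝ) L}

/-- Lebesgue measure on the square `[0, L]²`. -/
def squareMeasure (L : ℝ) : Measure Plane := (volume : Measure Plane).restrict (square L)

/-- `W` (of which only the values on the square matter) is a zero-mean Gaussian random field on
`[0, L]²` with almost surely continuous paths. -/
structure IsCenteredContinuousGRF {Ω : Type*} [MeasurableSpace Ω] (P : Measure Ω) (L : ℝ)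
    (W : Plane → Ω → ℝ) : Prop where
  gaussian : IsGaussianProcess (fun z : square L => W z) P
  mean_zero : ∀ z ∈ square L, ∫ ω, W z ω ∂P = 0
  continuous_paths : ∀ᵐ ω ∂P, ContinuousOn (fun z => W z ω) (square L)

/-- The covariance function `q(z, z') = Cov(W(z), W(z'))`. -/
def covFun {Ω : Type*} [MeasurableSpace Ω] (P : Measure Ω) (W : Plane → Ω → ℝ) (z z' : Plane) : ℝ :=
  covariance (W z) (W z') P

/-- The integral operator `(Q φ)(z) = ∫_{[0, L]²} q(z, z') φ(z') dz'` with kernel `q`. -/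
def covOperator (L : ℝ) (q : Plane → Plane → ℝ) (φ : Plane → ℝ) (z : Plane) : ℝ :=
  ∫ z', q z z' * φ z' ∂(squareMeasure L)

/-- `(lam i, e i)`, `i ∈ ℕ`, are eigenpairs of the covariance operator of `W` on `L²([0, L]²)`, and
the `e i` are (representatives of) an orthonormal basis of `L²([0, L]²)`. -/
structure IsEigenbasis {Ω : Type*} [MeasurableSpace Ω] (P : Measure Ω) (L : ℝ)
    (W : Plane → Ω → ℝ) (lam : ℕ → ℝ) (e : ℕ → Plane → ℝ) : Prop where
  orthonormal_basis : ∃ b : HilbertBasis ℕ ℝ (Lp ℝ 2 (squareMeasure L)),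
    ∀ i, (b i : Plane → ℝ) =ᵐ[squareMeasure L] e i
  eigen : ∀ i, covOperator L (covFun P W) (e i) =ᵐ[squareMeasure L] fun z => lam i * e i z

/-- The functions `e i` are continuously differentiable on `[0, L]²`, bounded by `Ce`, and their
gradients are bounded by `Ce * i ^ α`, where the numbering is shifted to begin at `i = 1`. For
continuous functions the essential supremum over the square is the supremum, and the operator norm
of the derivative is the Euclidean norm of the gradient. -/
structure EigenfunctionBounds (L α Ce : ℝ) (e : ℕ → Plane → ℝ) : Prop where
  contDiff : ∀ i, ContDiffOn ℝ 1 (e i) (square L)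
  bound : ∀ i, ∀ z ∈ square L, |e i z| ≤ Ce
  grad_bound : ∀ i, ∀ z ∈ square L,
    ‖fderivWithin ℝ (e i) (square L) z‖ ≤ Ce * ((i : ℝ) + 1) ^ α

/-- The standing assumption on the fields `W₁` on `[0, D]²` and `W₂` on `[0, K]²`. -/
structure FieldAssumption {Ω : Type*} [MeasurableSpace Ω] (P : Measure Ω)
    (D K α β Ce Clam : ℝ) (W₁ W₂ : Plane → Ω → ℝ) (lam₁ lam₂ : ℕ → ℝ)
    (e₁ e₂ : ℕ → Plane → ℝ) : Prop where
  grf₁ : IsCenteredContinuousGRF P D W₁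
  grf₂ : IsCenteredContinuousGRF P K W₂
  eigen₁ : IsEigenbasis P D W₁ lam₁ e₁
  eigen₂ : IsEigenbasis P K W₂ lam₂ e₂
  bounds₁ : EigenfunctionBounds D α Ce e₁
  bounds₂ : EigenfunctionBounds K α Ce e₂
  summable_eigenvalues : Summable fun i : ℕ => (lam₁ i + lam₂ i) * ((i : ℝ) + 1) ^ β
  sum_eigenvalues : ∑' i : ℕ, (lam₁ i + lam₂ i) * ((i : ℝ) + 1) ^ β ≤ Clam

/-- The node `(x_i, x_j)` of the equidistant grid `x_i = i L / M`, `i = 0, …, M`, on `[0, L]`. -/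
def node (L : ℝ) (M i j : ℕ) : Plane := !₂[(i : ℝ) * (L / M), (j : ℝ) * (L / M)]

/-- The index `i ∈ {0, …, M - 1}` of a grid interval `[x_i, x_{i+1}]` containing `x ∈ [0, L]`. -/
def cellIndex (L : ℝ) (M : ℕ) (x : ℝ) : ℕ := min ⌊x / (L / M)⌋₊ (M - 1)

/-- The relative position `(x - x_i) / (x_{i+1} - x_i) ∈ [0, 1]` of `x` in its grid interval. -/
def cellPos (L : ℝ) (M : ℕ) (x : ℝ) : ℝ := x / (L / M) - cellIndex L M x

/-- The piecewise bilinear interpolant, on the equidistant grid with `M` steps in each direction on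
`[0, L]²`, of the values of `w` at the nodes. -/
def bilinearInterp (L : ℝ) (M : ℕ) (w : Plane → ℝ) (z : Plane) : ℝ :=
  let i := cellIndex L M (z 0)
  let j := cellIndex L M (z 1)
  let s := cellPos L M (z 0)
  let t := cellPos L M (z 1)
  (1 - s) * (1 - t) * w (node L M i j) + s * (1 - t) * w (node L M (i + 1) j)
    + (1 - s) * t * w (node L M i (j + 1)) + s * t * w (node L M (i + 1) (j + 1))

/-- The approximation of the random field `W` by point evaluation on the grid, followed by bilinear
interpolation. -/
def approxField {Ω : Type*} (L : ℝ) (M : ℕ) (W : Plane → Ω → ℝ) (z : Plane) (ω : Ω) : ℝ :=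
  bilinearInterp L M (fun z' => W z' ω) z

/-- The `L^∞([0, L]²)` norm (essential supremum) of the path of the field `F` at `ω`. -/
def pathSupNorm {Ω : Type*} (L : ℝ) (F : Plane → Ω → ℝ) (ω : Ω) : ℝ≥0∞ :=
  eLpNorm (fun z => F z ω) ∞ (squareMeasure L)

/-- The norm `E(‖F‖_{L^∞([0, L]²)}^n)^{1/n}` of `L^n(Ω; L^∞([0, L]²))`. -/
def lnLinfNorm {Ω : Type*} [MeasurableSpace Ω] (P : Measure Ω) (n L : ℝ)
    (F : Plane → Ω → ℝ) : ℝ≥0∞ :=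
  (∫⁻ ω, pathSupNorm L F ω ^ n ∂P) ^ (1 / n)

end GRF

end

open Filter Topology

namespace GRF

/-! The proof is a Kolmogorov chaining argument driven by Mercer's expansion. Put `θ = min 1 (β / (2
* α))`. Since the eigenfunctions are uniformly bounded and the eigenvalues summable, the covariance
function is the uniformly convergent series of `covFun_eq_tsum`. Hence `Var (W x - W y) = ∑ lam i *
(e i x - e i y) ^ 2`. Interpolating between the sup bound and the gradient bound of `e i` turns this
into `Var (W x - W y) ≤ A * dist x y ^ (2 * θ)` (`variance_increment_le`).

For a continuous path, the interpolation error at any point is at most a sum over dyadic levels of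
maximal increments between neighbouring nodes (`enorm_sub_interp_le_tsum`). Each maximum is bounded
by the `p`-norm of the increments. At mesh `h` there are of order `(L / h) ^ 2` increments, each
with `p`-th moment of order `h ^ (θ * p)` by Gaussianity. As `γ < θ`, a large `p` makes `(θ - γ) * p
≥ 4`: this absorbs the number of nodes, leaves the factor `ε ^ (γ * p)` and keeps the series over
the levels convergent. Jensen's inequality then passes from `p` to `n ≤ p`. -/

/-! ### Grid geometry and pathwise dyadic chaining. -/

lemma Plane.norm_le_add (v : Plane) : ‖v‖ ≤ |v 0| + |v 1| := by
  rw [EuclideanSpace.norm_eq, Fin.sum_univ_two]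
  apply Real.sqrt_le_iff.2 ⟨by positivity, ?_⟩
  simp only [Real.norm_eq_abs]
  nlinarith [abs_nonneg (v 0), abs_nonneg (v 1)]

@[simp] lemma node_zero (L : ℝ) (M i j : ℕ) : node L M i j 0 = i * (L / M) := rfl

@[simp] lemma node_one (L : ℝ) (M i j : ℕ) : node L M i j 1 = j * (L / M) := rfl

lemma natCast_mul_div_mem_Icc {L : ℝ} (hL : 0 < L) {M i : ℕ} (hi : i ≤ M) :
    (i : ℝ) * (L / M) ∈ Set.Icc 0 L := by
  refine ⟨by positivity, ?_⟩
  rcases Nat.eq_zero_or_pos M with rfl | hM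
  · simp [hL.le]
  have hM' : (0 : ℝ) < M := by exact_mod_cast hM
  have hi' : (i : ℝ) ≤ M := by exact_mod_cast hi
  calc (i : ℝ) * (L / M) ≤ M * (L / M) := by gcongr
    _ = L := by field_simp

lemma node_mem_square {L : ℝ} (hL : 0 < L) {M i j : ℕ} (hi : i ≤ M) (hj : j ≤ M) :
    node L M i j ∈ square L := by
  intro k
  fin_cases k
  · exact natCast_mul_div_mem_Icc hL hi
  · exact natCast_mul_div_mem_Icc hL hj

lemma cellIndex_lt (L : ℝ) {M : ℕ} (hM : 0 < M) (x : ℝ) : cellIndex L M x < M := by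
  unfold cellIndex; omega

lemma cellPos_mem {L : ℝ} (hL : 0 < L) {M : ℕ} (hM : 0 < M) {x : ℝ} (hx : x ∈ Set.Icc 0 L) :
    cellPos L M x ∈ Set.Icc 0 1 := by
  have hM' : (0 : ℝ) < M := by exact_mod_cast hM
  have h0 : 0 ≤ x / (L / M) := div_nonneg hx.1 (by positivity)
  have h1 : x / (L / M) ≤ M := by
    rw [div_le_iff₀ (by positivity)]
    calc x ≤ L := hx.2
      _ = M * (L / M) := by field_simp
  unfold cellPos cellIndex
  have hc : ((M - 1 : ℕ) : ℝ) = M - 1 := by push_cast [Nat.cast_sub hM]; ring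
  constructor
  · have : (min ⌊x / (L / M)⌋₊ (M - 1) : ℕ) ≤ (⌊x / (L / M)⌋₊ : ℝ) := by
      exact_mod_cast min_le_left _ _
    linarith [Nat.floor_le h0]
  · rw [Nat.cast_min, hc]
    rcases min_choice (⌊x / (L / M)⌋₊ : ℝ) (M - 1) with h | h <;> rw [h]
    · linarith [Nat.lt_floor_add_one (x / (L / M))]
    · linarith

/-- Dyadic cells are nested, and the truncation at the right edge respects this. So the corner of
the fine cell is the coarse corner shifted by 0 or 1 fine steps in each coordinate. -/
lemma cellIndex_two_mul {L : ℝ} {M : ℕ} (x : ℝ) :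
    cellIndex L (2 * M) x / 2 = cellIndex L M x := by
  unfold cellIndex
  have : ⌊x / (L / M)⌋₊ = ⌊x / (L / (2 * M : ℕ))⌋₊ / 2 := by
    rw [← Nat.floor_div_natCast]
    congr 1
    push_cast
    rcases eq_or_ne L 0 with rfl | hL
    · simp
    rcases eq_or_ne (M : ℝ) 0 with hM | hM
    · simp [hM]
    field_simp
  omega

/-- The lower left corner of the grid cell containing `z`. -/
noncomputable def cellCorner (L : ℝ) (M : ℕ) (z : Plane) : Plane :=
  node L M (cellIndex L M (z 0)) (cellIndex L M (z 1))

lemma cellCorner_mem {L : ℝ} (hL : 0 < L) {M : ℕ} (hM : 0 < M) (z : Plane) :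
    cellCorner L M z ∈ square L :=
  node_mem_square hL (cellIndex_lt L hM _).le (cellIndex_lt L hM _).le

lemma abs_sub_cellIndex_mul_le {L : ℝ} (hL : 0 < L) {M : ℕ} (hM : 0 < M) {x : ℝ}
    (hx : x ∈ Set.Icc 0 L) : |cellIndex L M x * (L / M) - x| ≤ L / M := by
  have hM' : (0 : ℝ) < M := by exact_mod_cast hM
  have h := cellPos_mem hL hM hx
  have hp : 0 < L / M := by positivity
  have : cellIndex L M x * (L / M) - x = - (cellPos L M x * (L / M)) := by
    unfold cellPos; field_simp; ring
  rw [this, abs_neg, abs_of_nonneg (mul_nonneg h.1 hp.le)]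
  exact mul_le_of_le_one_left hp.le h.2

lemma dist_cellCorner_le {L : ℝ} (hL : 0 < L) {M : ℕ} (hM : 0 < M) {z : Plane}
    (hz : z ∈ square L) : dist (cellCorner L M z) z ≤ 2 * (L / M) := by
  rw [dist_eq_norm]
  refine (Plane.norm_le_add _).trans ?_
  have h0 := abs_sub_cellIndex_mul_le hL hM (hz 0)
  have h1 := abs_sub_cellIndex_mul_le hL hM (hz 1)
  simp only [cellCorner, PiLp.sub_apply, node_zero, node_one]
  linarith

lemma tendsto_cellCorner {L : ℝ} (hL : 0 < L) {M : ℕ} (hM : 0 < M) {z : Plane}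
    (hz : z ∈ square L) :
    Tendsto (fun k : ℕ => cellCorner L (M * 2 ^ k) z) atTop (𝓝[square L] z) := by
  refine tendsto_nhdsWithin_iff.2
    ⟨?_, Eventually.of_forall fun k => cellCorner_mem hL (by positivity) z⟩
  rw [tendsto_iff_dist_tendsto_zero]
  have h : Tendsto (fun k : ℕ => 2 * (L / M) * (1 / 2 : ℝ) ^ k) atTop (𝓝 0) := by
    simpa using (tendsto_pow_atTop_nhds_zero_of_lt_one (r := (1 / 2 : ℝ)) (by norm_num)
      (by norm_num)).const_mul (2 * (L / M))
  refine squeeze_zero (fun _ => dist_nonneg) (fun k => ?_) h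
  refine (dist_cellCorner_le hL (by positivity) hz).trans (le_of_eq ?_)
  push_cast
  rw [one_div, inv_pow]
  ring

/-- The sum of the `p`-th powers of the increments of `w` from the lower left corners of the cells of
the grid with `N` steps to the nodes, in the `r` times finer grid, at most one fine step away. -/
noncomputable def incrSum (L p : ℝ) (r N : ℕ) (w : Plane → ℝ) : ℝ≥0∞ :=
  ∑ x ∈ (Finset.range N ×ˢ Finset.range N) ×ˢ (Finset.range 2 ×ˢ Finset.range 2),
    ‖w (node L (r * N) (r * x.1.1 + x.2.1) (r * x.1.2 + x.2.2)) - w (node L N x.1.1 x.1.2)‖ₑ ^ p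

lemma enorm_sub_le_incrSum (L : ℝ) {p : ℝ} (hp : 0 < p) {r N i j a b : ℕ} (w : Plane → ℝ)
    (hi : i < N) (hj : j < N) (ha : a < 2) (hb : b < 2) :
    ‖w (node L (r * N) (r * i + a) (r * j + b)) - w (node L N i j)‖ₑ
      ≤ incrSum L p r N w ^ (1 / p) := by
  rw [one_div, ENNReal.le_rpow_inv_iff hp]
  exact Finset.single_le_sum
    (f := fun x : (ℕ × ℕ) × (ℕ × ℕ) =>
      ‖w (node L (r * N) (r * x.1.1 + x.2.1) (r * x.1.2 + x.2.2)) - w (node L N x.1.1 x.1.2)‖ₑ ^ p)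
    (fun _ _ => zero_le) (a := ((i, j), (a, b))) (by simp [*])

lemma enorm_cellCorner_sub_le (L : ℝ) {p : ℝ} (hp : 0 < p) {N : ℕ} (hN : 0 < N)
    (w : Plane → ℝ) (z : Plane) :
    ‖w (cellCorner L (2 * N) z) - w (cellCorner L N z)‖ₑ ≤ incrSum L p 2 N w ^ (1 / p) := by
  have key : ∀ x, cellIndex L (2 * N) x = 2 * cellIndex L N x + cellIndex L (2 * N) x % 2 := by
    intro x
    have := cellIndex_two_mul (L := L) (M := N) x
    omega
  unfold cellCorner
  rw [key (z 0), key (z 1)]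
  exact enorm_sub_le_incrSum L hp w (cellIndex_lt L hN _) (cellIndex_lt L hN _)
    (Nat.mod_lt _ two_pos) (Nat.mod_lt _ two_pos)

lemma abs_bilinear_sub_le {s t u c : ℝ} (hs : s ∈ Set.Icc (0 : ℝ) 1) (ht : t ∈ Set.Icc (0 : ℝ) 1)
    {w₀₀ w₁₀ w₀₁ w₁₁ : ℝ} (h₀₀ : |w₀₀ - c| ≤ u) (h₁₀ : |w₁₀ - c| ≤ u) (h₀₁ : |w₀₁ - c| ≤ u)
    (h₁₁ : |w₁₁ - c| ≤ u) :
    |(1 - s) * (1 - t) * w₀₀ + s * (1 - t) * w₁₀ + (1 - s) * t * w₀₁ + s * t * w₁₁ - c| ≤ u := by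
  have hs' : 0 ≤ 1 - s := by linarith [hs.2]
  have ht' : 0 ≤ 1 - t := by linarith [ht.2]
  rw [abs_le] at *
  have a₀₀ := mul_nonneg hs' ht'
  have a₁₀ := mul_nonneg hs.1 ht'
  have a₀₁ := mul_nonneg hs' ht.1
  have a₁₁ := mul_nonneg hs.1 ht.1
  constructor
  · nlinarith [mul_le_mul_of_nonneg_left h₀₀.1 a₀₀, mul_le_mul_of_nonneg_left h₁₀.1 a₁₀,
      mul_le_mul_of_nonneg_left h₀₁.1 a₀₁, mul_le_mul_of_nonneg_left h₁₁.1 a₁₁]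
  · nlinarith [mul_le_mul_of_nonneg_left h₀₀.2 a₀₀, mul_le_mul_of_nonneg_left h₁₀.2 a₁₀,
      mul_le_mul_of_nonneg_left h₀₁.2 a₀₁, mul_le_mul_of_nonneg_left h₁₁.2 a₁₁]

/-- The interpolant is a convex combination of the four vertex values, so its distance to the value
at the corner is at most the largest of the increments along the cell. These are the increments
collected by `incrSum` with `r = 1`. -/
lemma enorm_interp_sub_le {L : ℝ} (hL : 0 < L) {p : ℝ} (hp : 0 < p) {M : ℕ} (hM : 0 < M)
    (w : Plane → ℝ) {z : Plane} (hz : z ∈ square L) :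
    ‖bilinearInterp L M w z - w (cellCorner L M z)‖ₑ ≤ incrSum L p 1 M w ^ (1 / p) := by
  rcases eq_or_ne (incrSum L p 1 M w ^ (1 / p)) ∞ with h | h
  · exact h ▸ le_top
  have key : ∀ a b, a < 2 → b < 2 →
      |w (node L M (cellIndex L M (z 0) + a) (cellIndex L M (z 1) + b)) - w (cellCorner L M z)|
        ≤ (incrSum L p 1 M w ^ (1 / p)).toReal := by
    intro a b ha hb
    have := enorm_sub_le_incrSum L hp (r := 1) w (cellIndex_lt L hM (z 0))
      (cellIndex_lt L hM (z 1)) ha hb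
    simp only [one_mul] at this
    rw [← Real.norm_eq_abs, ← toReal_enorm]
    exact ENNReal.toReal_mono h this
  rw [← ofReal_norm, Real.norm_eq_abs]
  refine ENNReal.ofReal_le_of_le_toReal ?_
  exact abs_bilinear_sub_le (cellPos_mem hL hM (hz 0)) (cellPos_mem hL hM (hz 1))
    (key 0 0 (by simp) (by simp)) (key 1 0 (by simp) (by simp)) (key 0 1 (by simp) (by simp))
    (key 1 1 (by simp) (by simp))

/-- The increments used at the `k`-th step of the dyadic chaining started from the grid with `M`
steps. -/
noncomputable def chainTerm (L p : ℝ) (M : ℕ) (w : Plane → ℝ) : ℕ → ℝ≥0∞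
  | 0 => incrSum L p 1 M w
  | k + 1 => incrSum L p 2 (M * 2 ^ k) w

/-- The corners of the cells containing `z` converge to `z`, so continuity lets the path telescope
along them; the term `k = 0` accounts for the interpolation itself. The bound does not depend on
`z`, hence controls the supremum. -/
lemma enorm_sub_interp_le_tsum {L : ℝ} (hL : 0 < L) {p : ℝ} (hp : 0 < p) {M : ℕ} (hM : 0 < M)
    {w : Plane → ℝ} (hw : ContinuousOn w (square L)) {z : Plane} (hz : z ∈ square L) :
    ‖w z - bilinearInterp L M w z‖ₑ ≤ ∑' k, chainTerm L p M w k ^ (1 / p) := by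
  have hlim : Tendsto (fun k : ℕ => w (cellCorner L (M * 2 ^ k) z)) atTop (𝓝 (w z)) :=
    (hw z hz).tendsto.comp (tendsto_cellCorner hL hM hz)
  have hchain := edist_le_tsum_of_edist_le_of_tendsto₀
    (f := fun k : ℕ => w (cellCorner L (M * 2 ^ k) z))
    (fun k => chainTerm L p M w (k + 1) ^ (1 / p)) (fun k => by
      rw [edist_comm, edist_eq_enorm_sub, show M * 2 ^ (k + 1) = 2 * (M * 2 ^ k) by ring]
      exact enorm_cellCorner_sub_le L hp (by positivity) w z) hlim
  rw [tsum_eq_zero_add' ENNReal.summable, ← edist_eq_enorm_sub, edist_comm]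
  refine (edist_triangle _ (w (cellCorner L M z)) _).trans (add_le_add ?_ ?_)
  · rw [edist_eq_enorm_sub]
    exact enorm_interp_sub_le hL hp hM w hz
  · simpa using hchain

/-- With `S` the weighted sum, `v k ≤ 2⁻ᵏ S`, and the `p`-th roots of these bounds form a geometric
series. The right side is linear in `v`, so expectations can be taken term by term. -/
lemma tsum_rpow_le {p : ℝ} (hp : 0 < p) (v : ℕ → ℝ≥0∞) :
    (∑' k, v k ^ (1 / p)) ^ p
      ≤ (∑' k : ℕ, ((2 : ℝ≥0∞) ^ (-(1 / p))) ^ k) ^ p * ∑' k : ℕ, 2 ^ k * v k := by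
  set S := ∑' k : ℕ, 2 ^ k * v k with hS
  have hterm : ∀ k : ℕ, v k ^ (1 / p) ≤ ((2 : ℝ≥0∞) ^ (-(1 / p))) ^ k * S ^ (1 / p) := by
    intro k
    have h1 : 2 ^ k * v k ≤ S := ENNReal.le_tsum k
    have h2 : v k ≤ (2 ^ k)⁻¹ * S := by
      rw [← ENNReal.div_eq_inv_mul, ENNReal.le_div_iff_mul_le (by simp) (by simp), mul_comm]
      exact h1
    calc v k ^ (1 / p) ≤ ((2 ^ k)⁻¹ * S) ^ (1 / p) := ENNReal.rpow_le_rpow h2 (by positivity)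
      _ = _ := by
        rw [ENNReal.mul_rpow_of_nonneg _ _ (by positivity), ENNReal.inv_rpow,
          ENNReal.rpow_neg, ← ENNReal.inv_pow, ← ENNReal.rpow_natCast, ← ENNReal.rpow_natCast,
          ← ENNReal.rpow_mul, ← ENNReal.rpow_mul, mul_comm (k : ℝ)]
  calc (∑' k, v k ^ (1 / p)) ^ p
      ≤ (∑' k : ℕ, ((2 : ℝ≥0∞) ^ (-(1 / p))) ^ k * S ^ (1 / p)) ^ p :=
        ENNReal.rpow_le_rpow (ENNReal.tsum_le_tsum hterm) hp.le
    _ = _ := by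
        rw [ENNReal.tsum_mul_right, ENNReal.mul_rpow_of_nonneg _ _ hp.le, ← ENNReal.rpow_mul,
          one_div_mul_cancel hp.ne', ENNReal.rpow_one]

lemma tsum_two_rpow_ne_top {p : ℝ} (hp : 0 < p) :
    ∑' k : ℕ, ((2 : ℝ≥0∞) ^ (-(1 / p))) ^ k ≠ ∞ := by
  rw [ENNReal.tsum_geometric]
  simp only [ne_eq, ENNReal.inv_eq_top, tsub_eq_zero_iff_le, not_le]
  exact ENNReal.rpow_lt_one_of_one_lt_of_neg (by norm_num) (by simpa using hp)

/-! ### Centered Gaussian variables: variances and moments. -/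

variable {Ω : Type*} [MeasurableSpace Ω] {P : Measure Ω}

/-- This is the characteristic function at 1. It expresses the variance through the expectation of a
bounded function of `X`. -/
lemma exp_neg_variance_eq {X : Ω → ℝ} (hX : HasGaussianLaw X P) (hX0 : ∫ ω, X ω ∂P = 0) :
    Real.exp (-(Var[X; P] / 2)) = (∫ ω, Complex.exp (X ω * Complex.I) ∂P).re := by
  have h : ∫ ω, Complex.exp (X ω * Complex.I) ∂P = charFun (P.map X) 1 := by
    rw [charFun_apply_real, integral_map hX.aemeasurable (by fun_prop)]
    simp
  rw [h, hX.map_eq_gaussianReal, charFun_gaussianReal, hX0]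
  have : ((Var[X; P].toNNReal : NNReal) : ℂ) = ((Var[X; P] : ℝ) : ℂ) := by
    exact congrArg Complex.ofReal (Real.coe_toNNReal _ (variance_nonneg _ _))
  rw [this]
  have h2 : ((1 : ℝ) : ℂ) * ((0 : ℝ) : ℂ) * Complex.I - (Var[X; P] : ℝ) * ((1 : ℝ) : ℂ) ^ 2 / 2
      = ((-(Var[X; P] / 2) : ℝ) : ℂ) := by push_cast; ring
  rw [h2, Complex.exp_ofReal_re]

/-- If centered Gaussian variables converge almost surely, then so do their variances. -/
lemma tendsto_variance_of_ae_tendsto {ι : Type*} {l : Filter ι} [l.IsCountablyGenerated]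
    {X : ι → Ω → ℝ} {Y : Ω → ℝ} (hX : ∀ᶠ i in l, HasGaussianLaw (X i) P)
    (hX0 : ∀ᶠ i in l, ∫ ω, X i ω ∂P = 0) (hY : HasGaussianLaw Y P) (hY0 : ∫ ω, Y ω ∂P = 0)
    (h : ∀ᵐ ω ∂P, Tendsto (fun i => X i ω) l (𝓝 (Y ω))) :
    Tendsto (fun i => Var[X i; P]) l (𝓝 Var[Y; P]) := by
  have := hY.isProbabilityMeasure
  -- The integrands have modulus 1, so dominated convergence applies without any uniform
  -- integrability of the squares; a logarithm then recovers the variances.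
  have hc : Tendsto (fun i => ∫ ω, Complex.exp (X i ω * Complex.I) ∂P) l
      (𝓝 (∫ ω, Complex.exp (Y ω * Complex.I) ∂P)) := by
    refine tendsto_integral_filter_of_dominated_convergence (fun _ => 1) ?_ ?_
      (integrable_const _) ?_
    · filter_upwards [hX] with i hi
      have := hi.aemeasurable
      exact AEMeasurable.aestronglyMeasurable (by fun_prop)
    · filter_upwards with i
      filter_upwards with ω
      rw [Complex.norm_exp_ofReal_mul_I]
    · filter_upwards [h] with ω hω
      exact ((Complex.continuous_exp.comp
        (Complex.continuous_ofReal.mul continuous_const)).tendsto _).comp hω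
  have hr := (Complex.continuous_re.tendsto _).comp hc
  rw [← exp_neg_variance_eq hY hY0] at hr
  have hr' : Tendsto (fun i => Real.exp (-(Var[X i; P] / 2))) l
      (𝓝 (Real.exp (-(Var[Y; P] / 2)))) := by
    refine hr.congr' ?_
    filter_upwards [hX, hX0] with i hi hi0
    exact (exp_neg_variance_eq hi hi0).symm
  have hl := ((Real.continuousAt_log (Real.exp_pos _).ne').tendsto.comp hr').const_mul (-2)
  simp only [Function.comp_def, Real.log_exp] at hl
  convert! hl using 2 <;> ring

lemma lintegral_enorm_rpow_of_gaussian {X : Ω → ℝ} (hX : HasGaussianLaw X P)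
    (hX0 : ∫ ω, X ω ∂P = 0) {p : ℝ} (hp : 0 < p) :
    ∫⁻ ω, ‖X ω‖ₑ ^ p ∂P
      = ENNReal.ofReal Var[X; P] ^ (p / 2) * ∫⁻ x, ‖x‖ₑ ^ p ∂(gaussianReal 0 1) := by
  have hv := variance_nonneg X P
  have h1 : gaussianReal 0 (Var[X; P].toNNReal)
      = (gaussianReal 0 1).map (Real.sqrt Var[X; P] * ·) := by
    rw [gaussianReal_map_const_mul, mul_zero, mul_one]
    congr 1
    ext
    simp [Real.sq_sqrt hv, hv]
  calc ∫⁻ ω, ‖X ω‖ₑ ^ p ∂P = ∫⁻ x, ‖x‖ₑ ^ p ∂(P.map X) := by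
        rw [lintegral_map' (by fun_prop) hX.aemeasurable]
    _ = ∫⁻ x, ‖Real.sqrt Var[X; P] * x‖ₑ ^ p ∂(gaussianReal 0 1) := by
        rw [hX.map_eq_gaussianReal, hX0, h1, lintegral_map (by fun_prop) (by fun_prop)]
    _ = _ := by
        simp_rw [enorm_mul, ENNReal.mul_rpow_of_nonneg _ _ hp.le]
        rw [lintegral_const_mul _ (by fun_prop)]
        congr 1
        rw [Real.enorm_of_nonneg (Real.sqrt_nonneg _), Real.sqrt_eq_rpow,
          ← ENNReal.ofReal_rpow_of_nonneg hv (by norm_num), ← ENNReal.rpow_mul]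
        congr 1
        ring

lemma lintegral_gaussian_ne_top {p : ℝ} (hp : 0 < p) :
    ∫⁻ x, ‖x‖ₑ ^ p ∂(gaussianReal 0 1) ≠ ∞ := by
  have h := (memLp_id_gaussianReal' (μ := 0) (v := 1) (ENNReal.ofReal p)
    ENNReal.ofReal_ne_top).eLpNorm_lt_top
  have h2 := lintegral_rpow_enorm_lt_top_of_eLpNorm_lt_top (by simpa using hp)
    ENNReal.ofReal_ne_top h
  rw [ENNReal.toReal_ofReal hp.le] at h2
  exact h2.ne

/-! ### Continuity and formulas for the covariance function. -/

lemma covFun_comm (W : Plane → Ω → ℝ) (z z' : Plane) : covFun P W z z' = covFun P W z' z :=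
  covariance_comm _ _

namespace IsCenteredContinuousGRF

variable {L : ℝ} {W : Plane → Ω → ℝ} (hW : IsCenteredContinuousGRF P L W)
include hW

lemma law {z : Plane} (hz : z ∈ square L) : HasGaussianLaw (W z) P :=
  hW.gaussian.hasGaussianLaw_eval ⟨z, hz⟩

lemma memLp_two {z : Plane} (hz : z ∈ square L) : MemLp (W z) 2 P :=
  (hW.law hz).memLp_two

lemma aemeasurable {z : Plane} (hz : z ∈ square L) : AEMeasurable (W z) P :=
  (hW.law hz).aemeasurable

lemma isProbabilityMeasure : IsProbabilityMeasure P := hW.gaussian.isProbabilityMeasure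

lemma law_add {z z' : Plane} (hz : z ∈ square L) (hz' : z' ∈ square L) :
    HasGaussianLaw (fun ω => W z ω + W z' ω) P :=
  hW.gaussian.hasGaussianLaw_fun_add (s := ⟨z, hz⟩) (t := ⟨z', hz'⟩)

lemma law_sub {z z' : Plane} (hz : z ∈ square L) (hz' : z' ∈ square L) :
    HasGaussianLaw (fun ω => W z ω - W z' ω) P :=
  hW.gaussian.hasGaussianLaw_fun_sub (s := ⟨z, hz⟩) (t := ⟨z', hz'⟩)

lemma mean_add {z z' : Plane} (hz : z ∈ square L) (hz' : z' ∈ square L) :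
    ∫ ω, (W z ω + W z' ω) ∂P = 0 := by
  have := hW.isProbabilityMeasure
  rw [integral_add ((hW.memLp_two hz).integrable (by simp))
    ((hW.memLp_two hz').integrable (by simp)), hW.mean_zero z hz, hW.mean_zero z' hz', add_zero]

lemma mean_sub {z z' : Plane} (hz : z ∈ square L) (hz' : z' ∈ square L) :
    ∫ ω, (W z ω - W z' ω) ∂P = 0 := by
  have := hW.isProbabilityMeasure
  rw [integral_sub ((hW.memLp_two hz).integrable (by simp))
    ((hW.memLp_two hz').integrable (by simp)), hW.mean_zero z hz, hW.mean_zero z' hz', sub_zero]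

lemma continuousOn_variance : ContinuousOn (fun z => Var[W z; P]) (square L) := by
  intro z hz
  refine tendsto_variance_of_ae_tendsto ?_ ?_ (hW.law hz) (hW.mean_zero z hz) ?_
  · filter_upwards [self_mem_nhdsWithin] with y hy using hW.law hy
  · filter_upwards [self_mem_nhdsWithin] with y hy using hW.mean_zero y hy
  · filter_upwards [hW.continuous_paths] with ω hω using hω z hz

/-- Polarization reduces continuity of the covariance to that of variances of Gaussian variables,
where `tendsto_variance_of_ae_tendsto` applies. -/
lemma covFun_eq_polar {z z' : Plane} (hz : z ∈ square L) (hz' : z' ∈ square L) :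
    covFun P W z z'
      = (Var[fun ω => W z ω + W z' ω; P] - Var[W z; P] - Var[W z'; P]) / 2 := by
  have := hW.isProbabilityMeasure
  rw [variance_fun_add (hW.memLp_two hz) (hW.memLp_two hz'), covFun]
  ring

lemma continuousOn_covFun {x : Plane} (hx : x ∈ square L) :
    ContinuousOn (covFun P W x) (square L) := by
  have h : ContinuousOn (fun z => Var[fun ω => W x ω + W z ω; P]) (square L) := by
    intro z hz
    refine tendsto_variance_of_ae_tendsto ?_ ?_ (hW.law_add hx hz) (hW.mean_add hx hz) ?_
    · filter_upwards [self_mem_nhdsWithin] with y hy using hW.law_add hx hy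
    · filter_upwards [self_mem_nhdsWithin] with y hy using hW.mean_add hx hy
    · filter_upwards [hW.continuous_paths] with ω hω using (hω z hz).const_add _
  refine (((h.sub (continuousOn_const (c := Var[W x; P]))).sub
    hW.continuousOn_variance).div_const 2).congr ?_
  intro z hz
  exact hW.covFun_eq_polar hx hz

lemma covFun_eq_integral {z z' : Plane} (hz : z ∈ square L) (hz' : z' ∈ square L) :
    covFun P W z z' = ∫ ω, W z ω * W z' ω ∂P := by
  have := hW.isProbabilityMeasure
  rw [covFun, covariance_eq_sub (hW.memLp_two hz) (hW.memLp_two hz'), hW.mean_zero z hz, zero_mul,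
    sub_zero]
  rfl

lemma variance_sub {z z' : Plane} (hz : z ∈ square L) (hz' : z' ∈ square L) :
    Var[fun ω => W z ω - W z' ω; P]
      = covFun P W z z - 2 * covFun P W z z' + covFun P W z' z' := by
  have := hW.isProbabilityMeasure
  rw [variance_fun_sub (hW.memLp_two hz) (hW.memLp_two hz'), covFun, covFun, covFun,
    covariance_self (hW.aemeasurable hz), covariance_self (hW.aemeasurable hz')]

end IsCenteredContinuousGRF

/-! ### Joint measurability of the field and measurability of the path norm. -/

lemma measurable_cellIndex (L : ℝ) (M : ℕ) : Measurable (cellIndex L M) := by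
  unfold cellIndex
  fun_prop

lemma measurable_cellPos (L : ℝ) (M : ℕ) : Measurable (cellPos L M) := by
  unfold cellPos
  have := measurable_cellIndex L M
  fun_prop

lemma measurable_coord (k : Fin 2) : Measurable fun z : Plane => z k := by fun_prop

lemma measurable_node {α : Type*} [MeasurableSpace α] (L : ℝ) (M : ℕ) {c d : α → ℕ}
    (hc : Measurable c) (hd : Measurable d) : Measurable fun x => node L M (c x) (d x) := by
  have h : Measurable fun x : ℕ × ℕ => node L M x.1 x.2 := measurable_of_countable _
  exact h.comp (hc.prodMk hd)

lemma measurable_node_cellIndex (L : ℝ) (M a b : ℕ) :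
    Measurable fun z : Plane =>
      node L M (cellIndex L M (z 0) + a) (cellIndex L M (z 1) + b) :=
  measurable_node L M (((measurable_cellIndex L M).comp (measurable_coord 0)).add_const a)
    (((measurable_cellIndex L M).comp (measurable_coord 1)).add_const b)

lemma isCompact_square (L : ℝ) : IsCompact (square L) := by
  have : square L = (WithLp.toLp 2) '' (Set.univ.pi fun _ : Fin 2 => Set.Icc (0 : ℝ) L) := by
    ext z
    constructor
    · intro hz
      exact ⟨z.ofLp, fun k _ => hz k, rfl⟩
    · rintro ⟨y, hy, rfl⟩ k
      exact hy k trivial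
  rw [this]
  exact (isCompact_univ_pi fun _ => isCompact_Icc).image (PiLp.continuous_toLp 2 _)

lemma measurableSet_square (L : ℝ) : MeasurableSet (square L) :=
  (isCompact_square L).isClosed.measurableSet

lemma convex_square (L : ℝ) : Convex ℝ (square L) := by
  intro x hx y hy a b ha hb hab k
  exact convex_Icc (0 : ℝ) L (hx k) (hy k) ha hb hab

instance (L : ℝ) : IsFiniteMeasure (squareMeasure L) :=
  ⟨by rw [squareMeasure, Measure.restrict_apply_univ]; exact (isCompact_square L).measure_lt_top⟩

/-- A field with almost surely continuous paths has a jointly measurable version. -/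
lemma IsCenteredContinuousGRF.exists_measurable_version {L : ℝ} (hL : 0 < L)
    {W : Plane → Ω → ℝ} (hW : IsCenteredContinuousGRF P L W) :
    ∃ V : Plane × Ω → ℝ, Measurable V ∧ ∀ᵐ ω ∂P, ∀ z ∈ square L, V (z, ω) = W z ω := by
  classical
  have hn : ∀ x : ℕ × ℕ × ℕ, ∃ f : Ω → ℝ, Measurable f ∧
      (x.2.1 ≤ x.1 → x.2.2 ≤ x.1 → f =ᵐ[P] W (node L x.1 x.2.1 x.2.2)) := by
    intro x
    by_cases h : x.2.1 ≤ x.1 ∧ x.2.2 ≤ x.1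
    · have hm := hW.aemeasurable (node_mem_square hL h.1 h.2)
      exact ⟨hm.mk _, hm.measurable_mk, fun _ _ => hm.ae_eq_mk.symm⟩
    · exact ⟨0, measurable_const, fun h1 h2 => absurd ⟨h1, h2⟩ h⟩
  choose f hf hfW using hn
  have hjoint : Measurable fun y : (ℕ × ℕ × ℕ) × Ω => f y.1 y.2 :=
    measurable_from_prod_countable_right fun x => hf x
  let idx : ℕ → Plane → ℕ × ℕ × ℕ := fun k z =>
    (1 * 2 ^ k, cellIndex L (1 * 2 ^ k) (z 0), cellIndex L (1 * 2 ^ k) (z 1))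
  have hidx : ∀ k, Measurable (idx k) := fun k =>
    measurable_const.prodMk (((measurable_cellIndex L _).comp (measurable_coord 0)).prodMk
      ((measurable_cellIndex L _).comp (measurable_coord 1)))
  -- The grid nodes are countable, so measurable modifications there give jointly measurable
  -- approximations. The limsup is measurable everywhere and is a true limit along continuous paths.
  refine ⟨fun y => limsup (fun k => f (idx k y.1) y.2) atTop, ?_, ?_⟩
  · refine Measurable.limsup fun k => ?_
    exact hjoint.comp (((hidx k).comp measurable_fst).prodMk measurable_snd)
  · have hall : ∀ᵐ ω ∂P, ∀ x : ℕ × ℕ × ℕ, x.2.1 ≤ x.1 → x.2.2 ≤ x.1 →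
        f x ω = W (node L x.1 x.2.1 x.2.2) ω := by
      rw [ae_all_iff]
      intro x
      by_cases h : x.2.1 ≤ x.1 ∧ x.2.2 ≤ x.1
      · filter_upwards [hfW x h.1 h.2] with ω hω _ _ using hω
      · exact Eventually.of_forall fun ω h1 h2 => absurd ⟨h1, h2⟩ h
    filter_upwards [hall, hW.continuous_paths] with ω hω hc z hz
    refine Tendsto.limsup_eq ?_
    refine (((hc z hz).tendsto.comp (tendsto_cellCorner hL one_pos hz))).congr fun k => ?_
    exact (hω (idx k z) (cellIndex_lt L (by positivity) _).le
      (cellIndex_lt L (by positivity) _).le).symm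

/-- The essential supremum is at most `c` exactly when the section of the set `g > c` is null, and
the measure of a section depends measurably on `ω`. -/
lemma measurable_essSup {α : Type*} [MeasurableSpace α] {μ : Measure α} [SFinite μ]
    {g : α × Ω → ℝ≥0∞} (hg : Measurable g) : Measurable fun ω => essSup (fun z => g (z, ω)) μ := by
  refine measurable_of_Iic fun c => ?_
  have : (fun ω => essSup (fun z => g (z, ω)) μ) ⁻¹' Set.Iic c
      = (fun ω => μ ((fun z => (z, ω)) ⁻¹' (g ⁻¹' Set.Ioi c))) ⁻¹' {0} := by
    ext ω
    simp only [Set.mem_preimage, Set.mem_Iic, Set.mem_singleton_iff]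
    constructor
    · intro h
      have h2 : ∀ᵐ z ∂μ, g (z, ω) ≤ c :=
        (ENNReal.ae_le_essSup fun z => g (z, ω)).mono fun z hz => hz.trans h
      rw [ae_iff] at h2
      simpa [Set.preimage, Set.Ioi] using h2
    · intro h
      refine essSup_le_of_ae_le c ?_
      rw [EventuallyLE, ae_iff]
      simpa [Set.preimage, Set.Ioi] using h
  rw [this]
  exact measurable_measure_prodMk_right (hg measurableSet_Ioi) (measurableSet_singleton 0)

lemma aemeasurable_pathSupNorm {L : ℝ} (hL : 0 < L) {M : ℕ} (hM : 0 < M) {W : Plane → Ω → ℝ}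
    (hW : IsCenteredContinuousGRF P L W) :
    AEMeasurable (pathSupNorm L (fun z ω => W z ω - approxField L M W z ω)) P := by
  obtain ⟨V, hV, hVW⟩ := hW.exists_measurable_version hL
  have hnode : ∀ a b, Measurable fun y : Plane × Ω =>
      V (node L M (cellIndex L M (y.1 0) + a) (cellIndex L M (y.1 1) + b), y.2) := fun a b =>
    hV.comp (((measurable_node_cellIndex L M a b).comp measurable_fst).prodMk measurable_snd)
  have hpos : ∀ k, Measurable fun y : Plane × Ω => cellPos L M (y.1 k) := fun k =>
    (measurable_cellPos L M).comp ((measurable_coord k).comp measurable_fst)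
  have hint : Measurable fun y : Plane × Ω => bilinearInterp L M (fun z => V (z, y.2)) y.1 := by
    have h00 := hnode 0 0
    have h10 := hnode 1 0
    have h01 := hnode 0 1
    have h11 := hnode 1 1
    simp only [add_zero] at h00 h10 h01
    have p0 := hpos 0
    have p1 := hpos 1
    have p0' := measurable_const (a := (1 : ℝ)).sub p0
    have p1' := measurable_const (a := (1 : ℝ)).sub p1
    exact ((((p0'.mul p1').mul h00).add ((p0.mul p1').mul h10)).add
      ((p0'.mul p1).mul h01)).add ((p0.mul p1).mul h11)
  refine ⟨fun ω => essSup (fun z => ‖V (z, ω) - bilinearInterp L M (fun z' => V (z', ω)) z‖ₑ)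
    (squareMeasure L), measurable_essSup (g := fun y : Plane × Ω =>
      ‖V (y.1, y.2) - bilinearInterp L M (fun z' => V (z', y.2)) y.1‖ₑ) (hV.sub hint).enorm, ?_⟩
  filter_upwards [hVW] with ω hω
  rw [pathSupNorm, eLpNorm_exponent_top, eLpNormEssSup]
  refine essSup_congr_ae ?_
  filter_upwards [ae_restrict_mem (measurableSet_square L)] with z hz
  have h0 : ∀ x, cellIndex L M x ≤ M := fun x => (cellIndex_lt L hM x).le
  have h1 : ∀ x, cellIndex L M x + 1 ≤ M := fun x => cellIndex_lt L hM x
  simp only [approxField, bilinearInterp]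
  rw [hω z hz, hω _ (node_mem_square hL (h0 _) (h0 _)), hω _ (node_mem_square hL (h1 _) (h0 _)),
    hω _ (node_mem_square hL (h0 _) (h1 _)), hω _ (node_mem_square hL (h1 _) (h1 _))]

/-! ### Continuous functions on the square and positivity of the covariance operator. -/

lemma square_subset_closure_interior {L : ℝ} (hL : 0 < L) :
    square L ⊆ closure (interior (square L)) := by
  rw [(convex_square L).closure_interior_eq_closure_of_nonempty_interior]
  · exact subset_closure
  · refine ⟨!₂[L / 2, L / 2], mem_interior.2
      ⟨⋂ k : Fin 2, (fun z : Plane => z k) ⁻¹' Set.Ioo 0 L, ?_, ?_, ?_⟩⟩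
    · intro z hz k
      exact Set.Ioo_subset_Icc_self (Set.mem_iInter.1 hz k)
    · exact isOpen_iInter_of_finite fun k => isOpen_Ioo.preimage (by fun_prop)
    · refine Set.mem_iInter.2 fun k => ?_
      fin_cases k <;> constructor <;> simp <;> linarith

lemma ae_mem_square (L : ℝ) : ∀ᵐ z ∂(squareMeasure L), z ∈ square L :=
  ae_restrict_mem (measurableSet_square L)

lemma eqOn_square_of_ae_eq {L : ℝ} (hL : 0 < L) {f g : Plane → ℝ} (hf : ContinuousOn f (square L))
    (hg : ContinuousOn g (square L)) (h : f =ᵐ[squareMeasure L] g) : Set.EqOn f g (square L) :=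
  Measure.eqOn_of_ae_eq h hf hg (square_subset_closure_interior hL)

lemma aestronglyMeasurable_of_continuousOn {L : ℝ} {f : Plane → ℝ}
    (hf : ContinuousOn f (square L)) : AEStronglyMeasurable f (squareMeasure L) :=
  hf.aestronglyMeasurable (measurableSet_square L)

lemma memLp_of_continuousOn {L : ℝ} {f : Plane → ℝ}
    (hf : ContinuousOn f (square L)) (p : ℝ≥0∞) : MemLp f p (squareMeasure L) := by
  obtain ⟨C, hC⟩ := (isCompact_square L).exists_bound_of_continuousOn hf
  exact MemLp.of_bound (aestronglyMeasurable_of_continuousOn hf) C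
    ((ae_mem_square L).mono fun z hz => hC z hz)

lemma integrable_of_continuousOn {L : ℝ} {f : Plane → ℝ}
    (hf : ContinuousOn f (square L)) : Integrable f (squareMeasure L) :=
  memLp_one_iff_integrable.1 (memLp_of_continuousOn hf 1)

namespace IsCenteredContinuousGRF

variable {L : ℝ} {W : Plane → Ω → ℝ}

/-- The covariance operator is positive semidefinite on continuous functions. -/
lemma integral_mul_covOperator_nonneg (hL : 0 < L) (hW : IsCenteredContinuousGRF P L W)
    {φ : Plane → ℝ} (hφ : ContinuousOn φ (square L)) :
    0 ≤ ∫ z, φ z * covOperator L (covFun P W) φ z ∂(squareMeasure L) := by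
  have := hW.isProbabilityMeasure
  set μ := squareMeasure L with hμ
  obtain ⟨V, hV, hVW⟩ := hW.exists_measurable_version hL
  obtain ⟨B, hB⟩ := (isCompact_square L).exists_bound_of_continuousOn hW.continuousOn_variance
  obtain ⟨C, hC⟩ := (isCompact_square L).exists_bound_of_continuousOn hφ
  have hVz : ∀ z ∈ square L, (fun ω => V (z, ω)) =ᵐ[P] W z := fun z hz =>
    hVW.mono fun ω hω => hω z hz
  have hVmem : ∀ z ∈ square L, MemLp (fun ω => V (z, ω)) 2 P := fun z hz =>
    (memLp_congr_ae (hVz z hz)).2 (hW.memLp_two hz)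
  have hVsq : ∀ z ∈ square L, ∫ ω, V (z, ω) ^ 2 ∂P ≤ B := by
    intro z hz
    have h1 : ∫ ω, V (z, ω) ^ 2 ∂P = Var[W z; P] := by
      rw [variance_of_integral_eq_zero (hW.aemeasurable hz) (hW.mean_zero z hz)]
      exact integral_congr_ae ((hVz z hz).mono fun ω hω => by simp only [hω])
    rw [h1]
    exact (le_abs_self _).trans (hB z hz)
  let G : Plane → Ω → ℝ := fun z ω => φ z * V (z, ω)
  let f : Plane × Plane → Ω → ℝ := fun x ω => G x.1 ω * G x.2 ω
  have hφm : AEStronglyMeasurable φ μ := aestronglyMeasurable_of_continuousOn hφ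
  have hfm : AEStronglyMeasurable (Function.uncurry f) ((μ.prod μ).prod P) := by
    have h1 : AEStronglyMeasurable (fun y : (Plane × Plane) × Ω => φ y.1.1) ((μ.prod μ).prod P) :=
      (hφm.comp_fst (ν := μ)).comp_fst
    have h2 : AEStronglyMeasurable (fun y : (Plane × Plane) × Ω => φ y.1.2) ((μ.prod μ).prod P) :=
      (hφm.comp_snd (μ := μ)).comp_fst
    have h3 : AEStronglyMeasurable (fun y : (Plane × Plane) × Ω => V (y.1.1, y.2))
        ((μ.prod μ).prod P) :=
      (hV.comp (by fun_prop : Measurable fun y : (Plane × Plane) × Ω => (y.1.1, y.2))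
        ).aestronglyMeasurable
    have h4 : AEStronglyMeasurable (fun y : (Plane × Plane) × Ω => V (y.1.2, y.2))
        ((μ.prod μ).prod P) :=
      (hV.comp (by fun_prop : Measurable fun y : (Plane × Plane) × Ω => (y.1.2, y.2))
        ).aestronglyMeasurable
    exact (h1.mul h3).mul (h2.mul h4)
  have hmem : ∀ᵐ x ∂(μ.prod μ), x.1 ∈ square L ∧ x.2 ∈ square L := by
    rw [hμ, squareMeasure, Measure.prod_restrict]
    exact ae_restrict_mem ((measurableSet_square L).prod (measurableSet_square L))
  have hG : ∀ z ∈ square L, MemLp (G z) 2 P := fun z hz => (hVmem z hz).const_mul _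
  -- Fubini is justified by `|V V'| ≤ (V ^ 2 + V' ^ 2) / 2`, whose expectation is bounded uniformly
  -- over the square because the variance is continuous there.
  have hfint : Integrable (Function.uncurry f) ((μ.prod μ).prod P) := by
    rw [integrable_prod_iff hfm]
    refine ⟨?_, ?_⟩
    · filter_upwards [hmem] with x hx
      exact (hG _ hx.1).integrable_mul (hG _ hx.2)
    · refine Integrable.of_bound hfm.norm.integral_prod_right' (C ^ 2 * B) ?_
      filter_upwards [hmem] with x hx
      rw [Real.norm_of_nonneg (integral_nonneg fun _ => norm_nonneg _)]
      have hsq : ∀ z ∈ square L, Integrable (fun ω => V (z, ω) ^ 2) P := fun z hz =>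
        (hVmem z hz).integrable_sq
      calc ∫ ω, ‖f x ω‖ ∂P
          ≤ ∫ ω, C ^ 2 * ((V (x.1, ω) ^ 2 + V (x.2, ω) ^ 2) / 2) ∂P := by
            refine integral_mono ((hG _ hx.1).integrable_mul (hG _ hx.2)).norm
              ((((hsq _ hx.1).add (hsq _ hx.2)).div_const 2).const_mul _) fun ω => ?_
            have e1 : ‖f x ω‖ = (|φ x.1| * |φ x.2|) * (|V (x.1, ω)| * |V (x.2, ω)|) := by
              simp only [f, G, norm_mul, Real.norm_eq_abs]; ring
            have e2 : |φ x.1| * |φ x.2| ≤ C ^ 2 := by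
              rw [sq]
              exact mul_le_mul (hC _ hx.1) (hC _ hx.2) (abs_nonneg _)
                ((abs_nonneg _).trans (hC _ hx.1))
            have e3 : |V (x.1, ω)| * |V (x.2, ω)| ≤ (V (x.1, ω) ^ 2 + V (x.2, ω) ^ 2) / 2 := by
              rw [← sq_abs (V (x.1, ω)), ← sq_abs (V (x.2, ω))]
              nlinarith [sq_nonneg (|V (x.1, ω)| - |V (x.2, ω)|)]
            simp only [e1]
            exact mul_le_mul e2 e3 (by positivity) (by positivity)
        _ ≤ C ^ 2 * B := by
            rw [integral_const_mul, integral_div, integral_add (hsq _ hx.1) (hsq _ hx.2)]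
            have := hVsq _ hx.1
            have := hVsq _ hx.2
            gcongr
            linarith
  have h1 : ∫ z, φ z * covOperator L (covFun P W) φ z ∂μ
      = ∫ x, ∫ ω, f x ω ∂P ∂(μ.prod μ) := by
    rw [integral_prod (fun x => ∫ ω, f x ω ∂P) hfint.integral_prod_left]
    refine integral_congr_ae ?_
    filter_upwards [ae_mem_square L] with z hz
    rw [covOperator, ← integral_const_mul]
    refine integral_congr_ae ?_
    filter_upwards [ae_mem_square L] with z' hz'
    rw [hW.covFun_eq_integral hz hz', mul_comm _ (φ z'), ← mul_assoc, ← integral_const_mul]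
    refine integral_congr_ae ?_
    filter_upwards [hVz z hz, hVz z' hz'] with ω h h'
    simp only [f, G, h, h']
    ring
  -- For fixed `ω` the double integral over the square is the square of `∫ φ V(·, ω)`.
  rw [h1, integral_integral_swap hfint]
  refine integral_nonneg fun ω => ?_
  simp only [f, Pi.zero_apply]
  rw [integral_prod_mul (fun z => G z ω) (fun z => G z ω)]
  exact mul_self_nonneg _

end IsCenteredContinuousGRF

/-! ### Mercer's expansion and the Hölder bound for the increments. -/

lemma EigenfunctionBounds.continuousOn {L α Ce : ℝ} {e : ℕ → Plane → ℝ}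
    (hB : EigenfunctionBounds L α Ce e) (i : ℕ) : ContinuousOn (e i) (square L) :=
  (hB.contDiff i).continuousOn

namespace IsEigenbasis

variable {L α Ce : ℝ} {W : Plane → Ω → ℝ} {lam : ℕ → ℝ} {e : ℕ → Plane → ℝ}

lemma integral_mul (hE : IsEigenbasis P L W lam e) (i j : ℕ) :
    ∫ z, e i z * e j z ∂(squareMeasure L) = if i = j then 1 else 0 := by
  obtain ⟨b, hb⟩ := hE.orthonormal_basis
  rw [← orthonormal_iff_ite.1 b.orthonormal i j, L2.inner_def]
  refine integral_congr_ae ?_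
  filter_upwards [hb i, hb j] with z hi hj
  simp [hi, hj, mul_comm]

/-- `lam i` is the quadratic form of the covariance operator at the unit vector `e i`. Nonnegativity
is what allows the joint eigenvalue sum to control each field separately. -/
lemma eigenvalue_nonneg (hL : 0 < L) (hW : IsCenteredContinuousGRF P L W)
    (hE : IsEigenbasis P L W lam e) (hB : EigenfunctionBounds L α Ce e) (i : ℕ) : 0 ≤ lam i := by
  have h := hW.integral_mul_covOperator_nonneg hL (hB.continuousOn i)
  have h2 : ∫ z, e i z * covOperator L (covFun P W) (e i) z ∂(squareMeasure L) = lam i := by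
    calc _ = ∫ z, lam i * (e i z * e i z) ∂(squareMeasure L) := by
          refine integral_congr_ae ?_
          filter_upwards [hE.eigen i] with z hz
          rw [hz]; ring
      _ = lam i := by rw [integral_const_mul, hE.integral_mul]; simp
  rwa [h2] at h

/-- Functions in `L²` with equal Fourier coefficients with respect to the eigenbasis coincide. -/
lemma ae_eq_of_coeff_eq (hE : IsEigenbasis P L W lam e) {f g : Plane → ℝ}
    (hf : MemLp f 2 (squareMeasure L)) (hg : MemLp g 2 (squareMeasure L))
    (h : ∀ i, ∫ z, f z * e i z ∂(squareMeasure L) = ∫ z, g z * e i z ∂(squareMeasure L)) :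
    f =ᵐ[squareMeasure L] g := by
  obtain ⟨b, hb⟩ := hE.orthonormal_basis
  rw [← MemLp.toLp_eq_toLp_iff hf hg]
  have key : ∀ (u : Plane → ℝ) (hu : MemLp u 2 (squareMeasure L)) (i : ℕ),
      b.repr (hu.toLp u) i = ∫ z, u z * e i z ∂(squareMeasure L) := by
    intro u hu i
    rw [b.repr_apply_apply, L2.inner_def]
    refine integral_congr_ae ?_
    filter_upwards [hb i, hu.coeFn_toLp] with z h1 h2
    simp [h1, h2]
  refine b.repr.injective (lp.ext (funext fun i => ?_))
  rw [key, key, h]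

lemma continuousOn_kernel (hB : EigenfunctionBounds L α Ce e) (hlam : ∀ i, 0 ≤ lam i)
    (hsum : Summable lam) {x : Plane} (hx : x ∈ square L) :
    ContinuousOn (fun y => ∑' i, lam i * e i x * e i y) (square L) := by
  refine continuousOn_tsum (fun i => continuousOn_const.mul (hB.continuousOn i))
    (hsum.mul_right (Ce ^ 2)) fun i y hy => ?_
  rw [norm_mul, norm_mul, Real.norm_of_nonneg (hlam i), mul_assoc, sq]
  exact mul_le_mul_of_nonneg_left (mul_le_mul (hB.bound i x hx) (hB.bound i y hy) (abs_nonneg _)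
    ((abs_nonneg _).trans (hB.bound i x hx))) (hlam i)

/-- Mercer's expansion of the covariance function. -/
lemma covFun_eq_tsum (hL : 0 < L) (hW : IsCenteredContinuousGRF P L W)
    (hE : IsEigenbasis P L W lam e) (hB : EigenfunctionBounds L α Ce e) (hlam : ∀ i, 0 ≤ lam i)
    (hsum : Summable lam) {x y : Plane} (hx : x ∈ square L) (hy : y ∈ square L) :
    covFun P W x y = ∑' i, lam i * e i x * e i y := by
  -- Termwise integration is legitimate because the `i`-th term is dominated by `lam i * Ce ^ 3` on
  -- a square of finite measure.
  have hcoeff : ∀ x ∈ square L, ∀ j,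
      ∫ y, (∑' i, lam i * e i x * e i y) * e j y ∂(squareMeasure L) = lam j * e j x := by
    intro x hx j
    have hcont : ∀ i, ContinuousOn (fun y => lam i * e i x * e i y * e j y) (square L) := fun i =>
      (continuousOn_const.mul (hB.continuousOn i)).mul (hB.continuousOn j)
    have h := hasSum_integral_of_summable_integral_norm (μ := squareMeasure L)
      (F := fun i y => lam i * e i x * e i y * e j y) (fun i => integrable_of_continuousOn (hcont i))
      (by
        refine Summable.of_nonneg_of_le (fun i => integral_nonneg fun _ => norm_nonneg _)
          (fun i => ?_) (hsum.mul_right (Ce ^ 3 * (squareMeasure L).real Set.univ))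
        calc ∫ y, ‖lam i * e i x * e i y * e j y‖ ∂(squareMeasure L)
            ≤ ∫ _, lam i * Ce ^ 3 ∂(squareMeasure L) := by
              refine integral_mono_ae (integrable_of_continuousOn (hcont i)).norm
                (integrable_const _) ?_
              filter_upwards [ae_mem_square L] with y hy
              have h0 := (abs_nonneg _).trans (hB.bound i x hx)
              simp only [norm_mul, Real.norm_eq_abs, abs_of_nonneg (hlam i)]
              calc lam i * |e i x| * |e i y| * |e j y| ≤ lam i * Ce * Ce * Ce := by
                    have := hlam i
                    gcongr
                    exacts [hB.bound i x hx, hB.bound i y hy, hB.bound j y hy]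
                _ = lam i * Ce ^ 3 := by ring
          _ = _ := by rw [integral_const, smul_eq_mul]; ring)
    have h1 : ∀ i, ∫ y, lam i * e i x * e i y * e j y ∂(squareMeasure L)
        = if i = j then lam j * e j x else 0 := by
      intro i
      simp_rw [mul_assoc (lam i * e i x)]
      rw [integral_const_mul, hE.integral_mul]
      split_ifs with hij
      · rw [hij, mul_one]
      · rw [mul_zero]
    simp_rw [h1] at h
    simp_rw [← tsum_mul_right]
    exact h.unique (hasSum_ite_eq j _)
  -- For almost every `x` the eigenvalue equations hold at `x` for all `j` at once and say that both
  -- sides have the same Fourier coefficients in `y`; continuity in `y` removes the null set of `y`.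
  have hrow : ∀ᵐ x ∂(squareMeasure L), ∀ y ∈ square L,
      covFun P W x y = ∑' i, lam i * e i x * e i y := by
    filter_upwards [ae_mem_square L, ae_all_iff.2 hE.eigen] with x hx heig
    have hc := hW.continuousOn_covFun hx
    have hk := continuousOn_kernel hB hlam hsum hx
    refine eqOn_square_of_ae_eq hL hc hk (hE.ae_eq_of_coeff_eq (memLp_of_continuousOn hc 2)
      (memLp_of_continuousOn hk 2) fun j => ?_)
    rw [hcoeff x hx j, ← heig j]
    rfl
  -- The exceptional `x` are removed by fixing `y` and using symmetry and continuity in the other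
  -- variable.
  have hcol : (fun x => covFun P W x y) =ᵐ[squareMeasure L]
      fun x => ∑' i, lam i * e i y * e i x := by
    filter_upwards [hrow] with x hx
    rw [hx y hy]
    congr 1 with i
    ring
  have hc : ContinuousOn (fun x => covFun P W x y) (square L) :=
    (hW.continuousOn_covFun hy).congr fun x _ => covFun_comm W x y
  refine (eqOn_square_of_ae_eq hL hc (continuousOn_kernel hB hlam hsum hy) hcol hx).trans ?_
  congr 1 with i
  ring

/-- The sup bound gives `2 * Ce` and the gradient bound gives `Ce * r` with `r = (i + 1) ^ α * dist
x y`; then `min 1 r ≤ r ^ θ`. -/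
lemma abs_eigenfunction_sub_le (hB : EigenfunctionBounds L α Ce e) (hCe : 0 < Ce) {θ : ℝ}
    (hθ0 : 0 < θ) (hθ1 : θ ≤ 1) (i : ℕ) {x y : Plane} (hx : x ∈ square L) (hy : y ∈ square L) :
    |e i x - e i y| ≤ 2 * Ce * (((i : ℝ) + 1) ^ α * dist x y) ^ θ := by
  have h1 : |e i x - e i y| ≤ 2 * Ce := by
    have := abs_sub (e i x) (e i y)
    linarith [hB.bound i x hx, hB.bound i y hy]
  have h2 : |e i x - e i y| ≤ Ce * ((i : ℝ) + 1) ^ α * dist x y := by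
    have := (convex_square L).norm_image_sub_le_of_norm_fderivWithin_le
      ((hB.contDiff i).differentiableOn (by norm_num)) (hB.grad_bound i) hy hx
    rwa [Real.norm_eq_abs, ← dist_eq_norm] at this
  set r := ((i : ℝ) + 1) ^ α * dist x y with hr
  have hr0 : 0 ≤ r := by positivity
  rcases le_total r 1 with h | h
  · have : r ≤ r ^ θ := by
      simpa using Real.rpow_le_rpow_of_exponent_ge' hr0 h hθ0.le hθ1
    calc |e i x - e i y| ≤ Ce * r := by rw [hr, ← mul_assoc]; exact h2
      _ ≤ 2 * Ce * r ^ θ := by nlinarith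
  · have : 1 ≤ r ^ θ := Real.one_le_rpow h hθ0.le
    nlinarith

lemma variance_increment_le (hL : 0 < L) (hW : IsCenteredContinuousGRF P L W)
    (hE : IsEigenbasis P L W lam e) (hB : EigenfunctionBounds L α Ce e) (hCe : 0 < Ce)
    (hlam : ∀ i, 0 ≤ lam i) {β Clam θ : ℝ} (hβ : 0 ≤ β)
    (hsum : Summable fun i : ℕ => lam i * ((i : ℝ) + 1) ^ β)
    (hle : ∑' i : ℕ, lam i * ((i : ℝ) + 1) ^ β ≤ Clam) (hθ0 : 0 < θ) (hθ1 : θ ≤ 1)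
    (hθ : 2 * α * θ ≤ β) {x y : Plane} (hx : x ∈ square L) (hy : y ∈ square L) :
    Var[fun ω => W x ω - W y ω; P] ≤ 4 * Ce ^ 2 * Clam * dist x y ^ (2 * θ) := by
  have hone : ∀ i : ℕ, (1 : ℝ) ≤ (i : ℝ) + 1 := fun i => by
    linarith [(Nat.cast_nonneg i : (0 : ℝ) ≤ i)]
  have hsum' : Summable lam := Summable.of_nonneg_of_le hlam
    (fun i => le_mul_of_one_le_right (hlam i) (Real.one_le_rpow (hone i) hβ)) hsum
  have hs : ∀ x ∈ square L, ∀ y ∈ square L, Summable fun i => lam i * e i x * e i y := by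
    intro x hx y hy
    refine Summable.of_norm_bounded (hsum'.mul_right (Ce ^ 2)) fun i => ?_
    rw [norm_mul, norm_mul, Real.norm_of_nonneg (hlam i), mul_assoc, sq]
    exact mul_le_mul_of_nonneg_left (mul_le_mul (hB.bound i x hx) (hB.bound i y hy) (abs_nonneg _)
      hCe.le) (hlam i)
  have hvar : HasSum (fun i => lam i * (e i x - e i y) ^ 2) Var[fun ω => W x ω - W y ω; P] := by
    rw [hW.variance_sub hx hy, covFun_eq_tsum hL hW hE hB hlam hsum' hx hx,
      covFun_eq_tsum hL hW hE hB hlam hsum' hx hy, covFun_eq_tsum hL hW hE hB hlam hsum' hy hy]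
    convert! (((hs x hx x hx).hasSum.sub ((hs x hx y hy).hasSum.mul_left 2)).add
      (hs y hy y hy).hasSum) using 2
    ring
  have hbound : ∀ i, lam i * (e i x - e i y) ^ 2
      ≤ 4 * Ce ^ 2 * dist x y ^ (2 * θ) * (lam i * ((i : ℝ) + 1) ^ β) := by
    intro i
    have h0 : (0 : ℝ) ≤ (i : ℝ) + 1 := zero_le_one.trans (hone i)
    have h1 := abs_eigenfunction_sub_le hB hCe hθ0 hθ1 i hx hy
    have h2 : (e i x - e i y) ^ 2 ≤ (2 * Ce * (((i : ℝ) + 1) ^ α * dist x y) ^ θ) ^ 2 := by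
      rw [← sq_abs]; gcongr
    -- Squaring produces the weight `(i + 1) ^ (2 * α * θ)`, which the summability assumption covers
    -- as `2 * α * θ ≤ β`.
    have h3 : ((((i : ℝ) + 1) ^ α * dist x y) ^ θ) ^ 2
        ≤ ((i : ℝ) + 1) ^ β * dist x y ^ (2 * θ) := by
      rw [← Real.rpow_natCast, ← Real.rpow_mul (by positivity),
        Real.mul_rpow (by positivity) dist_nonneg, ← Real.rpow_mul h0]
      have : θ * ((2 : ℕ) : ℝ) = 2 * θ := by push_cast; ring
      rw [this]
      refine mul_le_mul_of_nonneg_right ?_ (by positivity)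
      exact Real.rpow_le_rpow_of_exponent_le (hone i) (by linarith)
    calc lam i * (e i x - e i y) ^ 2
        ≤ lam i * (4 * Ce ^ 2 * (((i : ℝ) + 1) ^ β * dist x y ^ (2 * θ))) := by
          refine mul_le_mul_of_nonneg_left (h2.trans ?_) (hlam i)
          rw [mul_pow]
          nlinarith [sq_nonneg Ce]
      _ = _ := by ring
  have := hasSum_le hbound hvar (hsum.hasSum.mul_left _)
  calc _ ≤ _ := this
    _ ≤ 4 * Ce ^ 2 * dist x y ^ (2 * θ) * Clam := by gcongr
    _ = _ := by ring

end IsEigenbasis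

/-! ### Moment bounds along the chain and the interpolation error. -/

lemma dist_node_le {L : ℝ} (hL : 0 < L) {r N : ℕ} (hr : 0 < r) (hN : 0 < N) (i j : ℕ) {a b : ℕ}
    (ha : a ≤ r) (hb : b ≤ r) :
    dist (node L (r * N) (r * i + a) (r * j + b)) (node L N i j) ≤ 2 * (L / N) := by
  have hr' : (0 : ℝ) < r := by exact_mod_cast hr
  have hN' : (0 : ℝ) < N := by exact_mod_cast hN
  have key : ∀ i a : ℕ, a ≤ r →
      |((r * i + a : ℕ) : ℝ) * (L / ((r * N : ℕ) : ℝ)) - i * (L / N)| ≤ L / N := by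
    intro i a ha
    have ha' : (a : ℝ) / r ≤ 1 := (div_le_one hr').2 (by exact_mod_cast ha)
    have : ((r * i + a : ℕ) : ℝ) * (L / ((r * N : ℕ) : ℝ)) - i * (L / N) = a / r * (L / N) := by
      push_cast; field_simp; ring
    rw [this, abs_of_nonneg (by positivity)]
    exact mul_le_of_le_one_left (by positivity) ha'
  rw [dist_eq_norm]
  refine (Plane.norm_le_add _).trans ?_
  simp only [PiLp.sub_apply, node_zero, node_one]
  linarith [key i a ha, key j b hb]

lemma refine_index_le {r N i a : ℕ} (hr : 0 < r) (hi : i < N) (ha : a < 2) :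
    r * i + a ≤ r * N := by
  have : r * (i + 1) ≤ r * N := Nat.mul_le_mul_left r hi
  rw [mul_add, mul_one] at this
  omega

/-- The constant in the interpolation error bound on `[0, L]²` for a field whose increments have
variance at most `A * dist x y ^ (2 * θ)`. -/
noncomputable def interpConst (A θ γ L p : ℝ) : ℝ≥0∞ :=
  -- The 8 is the number 4 of offsets per node times `∑ 2⁻ᵏ = 2`; `L ^ 2` comes from the number `(L
  -- / h) ^ 2` of nodes at mesh `h`, and `4 ^ (θ * p)` from the distance bound `4 * h`.
  ((∑' k : ℕ, ((2 : ℝ≥0∞) ^ (-(1 / p))) ^ k) ^ p *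
    (ENNReal.ofReal (8 * L ^ 2 * A ^ (p / 2) * 4 ^ (θ * p) * L ^ ((θ - γ) * p - 2)) *
      ∫⁻ x, ‖x‖ₑ ^ p ∂(gaussianReal 0 1))) ^ (1 / p)

lemma interpConst_ne_top (A θ γ L : ℝ) {p : ℝ} (hp : 0 < p) : interpConst A θ γ L p ≠ ∞ := by
  unfold interpConst
  refine ENNReal.rpow_ne_top_of_nonneg (by positivity) (ENNReal.mul_ne_top ?_
    (ENNReal.mul_ne_top ENNReal.ofReal_ne_top (lintegral_gaussian_ne_top hp)))
  exact ENNReal.rpow_ne_top_of_nonneg hp.le (tsum_two_rpow_ne_top hp)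

namespace IsCenteredContinuousGRF

variable {L : ℝ} {W : Plane → Ω → ℝ} (hW : IsCenteredContinuousGRF P L W)
include hW

lemma lintegral_increment_le {A θ p d : ℝ} (hA : 0 ≤ A) (hθ : 0 < θ) (hp : 0 < p)
    (hvar : ∀ x ∈ square L, ∀ y ∈ square L,
      Var[fun ω => W x ω - W y ω; P] ≤ A * dist x y ^ (2 * θ))
    {x y : Plane} (hx : x ∈ square L) (hy : y ∈ square L) (hd : dist x y ≤ d) :
    ∫⁻ ω, ‖W x ω - W y ω‖ₑ ^ p ∂P
      ≤ ENNReal.ofReal (A ^ (p / 2) * d ^ (θ * p)) * ∫⁻ x, ‖x‖ₑ ^ p ∂(gaussianReal 0 1) := by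
  have hd0 : 0 ≤ d := dist_nonneg.trans hd
  rw [lintegral_enorm_rpow_of_gaussian (hW.law_sub hx hy) (hW.mean_sub hx hy) hp]
  gcongr
  rw [ENNReal.ofReal_rpow_of_nonneg (variance_nonneg _ _) (by positivity)]
  refine ENNReal.ofReal_le_ofReal ?_
  calc Var[fun ω => W x ω - W y ω; P] ^ (p / 2) ≤ (A * d ^ (2 * θ)) ^ (p / 2) := by
        refine Real.rpow_le_rpow (variance_nonneg _ _) ((hvar x hx y hy).trans ?_) (by positivity)
        gcongr
    _ = A ^ (p / 2) * d ^ (θ * p) := by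
        rw [Real.mul_rpow hA (by positivity), ← Real.rpow_mul hd0]
        congr 2
        ring

lemma aemeasurable_incrSum (hL : 0 < L) (p : ℝ) {r N : ℕ} (hr : 0 < r) :
    AEMeasurable (fun ω => incrSum L p r N fun z => W z ω) P := by
  unfold incrSum
  refine Finset.aemeasurable_fun_sum _ fun x hx => ?_
  simp only [Finset.mem_product, Finset.mem_range] at hx
  obtain ⟨⟨hi, hj⟩, ha, hb⟩ := hx
  exact ((hW.aemeasurable (node_mem_square hL (refine_index_le hr hi ha)
    (refine_index_le hr hj hb))).sub
      (hW.aemeasurable (node_mem_square hL hi.le hj.le))).enorm.pow_const p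

lemma lintegral_incrSum_le (hL : 0 < L) {A θ p : ℝ} (hA : 0 ≤ A) (hθ : 0 < θ) (hp : 0 < p)
    (hvar : ∀ x ∈ square L, ∀ y ∈ square L,
      Var[fun ω => W x ω - W y ω; P] ≤ A * dist x y ^ (2 * θ))
    {r N : ℕ} (hr : 0 < r) :
    ∫⁻ ω, incrSum L p r N (fun z => W z ω) ∂P
      ≤ ENNReal.ofReal (4 * N ^ 2 * (A ^ (p / 2) * (2 * (L / N)) ^ (θ * p))) *
        ∫⁻ x, ‖x‖ₑ ^ p ∂(gaussianReal 0 1) := by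
  unfold incrSum
  rw [lintegral_finsetSum']
  · refine (Finset.sum_le_card_nsmul _ _
      (ENNReal.ofReal (A ^ (p / 2) * (2 * (L / N)) ^ (θ * p)) *
        ∫⁻ x, ‖x‖ₑ ^ p ∂(gaussianReal 0 1)) fun x hx => ?_).trans (le_of_eq ?_)
    · simp only [Finset.mem_product, Finset.mem_range] at hx
      obtain ⟨⟨hi, hj⟩, ha, hb⟩ := hx
      exact hW.lintegral_increment_le hA hθ hp hvar
        (node_mem_square hL (refine_index_le hr hi ha) (refine_index_le hr hj hb))
        (node_mem_square hL hi.le hj.le)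
        (dist_node_le hL hr (Nat.zero_lt_of_lt hi) _ _ (by omega) (by omega))
    · have hc : (((Finset.range N ×ˢ Finset.range N) ×ˢ (Finset.range 2 ×ˢ Finset.range 2)).card
          : ℝ≥0∞) = ENNReal.ofReal (4 * N ^ 2) := by
        rw [Finset.card_product, Finset.card_product, Finset.card_product, Finset.card_range,
          Finset.card_range, ← ENNReal.ofReal_natCast]
        congr 1
        push_cast
        ring
      rw [nsmul_eq_mul, hc, ← mul_assoc, ← ENNReal.ofReal_mul (by positivity)]
  · intro x hx
    simp only [Finset.mem_product, Finset.mem_range] at hx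
    obtain ⟨⟨hi, hj⟩, ha, hb⟩ := hx
    exact ((hW.aemeasurable (node_mem_square hL (refine_index_le hr hi ha)
      (refine_index_le hr hj hb))).sub
        (hW.aemeasurable (node_mem_square hL hi.le hj.le))).enorm.pow_const p

lemma aemeasurable_chainTerm (hL : 0 < L) (p : ℝ) (M k : ℕ) :
    AEMeasurable (fun ω => chainTerm L p M (fun z => W z ω) k) P := by
  cases k with
  | zero => exact hW.aemeasurable_incrSum hL p one_pos
  | succ k => exact hW.aemeasurable_incrSum hL p two_pos

lemma lintegral_chainTerm_le (hL : 0 < L) {A θ p : ℝ} (hA : 0 ≤ A) (hθ : 0 < θ) (hp : 0 < p)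
    (hvar : ∀ x ∈ square L, ∀ y ∈ square L,
      Var[fun ω => W x ω - W y ω; P] ≤ A * dist x y ^ (2 * θ))
    {M : ℕ} (hM : 0 < M) (k : ℕ) :
    ∫⁻ ω, chainTerm L p M (fun z => W z ω) k ∂P
      ≤ ENNReal.ofReal (4 * (M * 2 ^ k) ^ 2 *
          (A ^ (p / 2) * (4 * (L / (M * 2 ^ k))) ^ (θ * p))) *
        ∫⁻ x, ‖x‖ₑ ^ p ∂(gaussianReal 0 1) := by
  have hM' : (0 : ℝ) < M := by exact_mod_cast hM
  cases k with
  | zero =>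
    refine (hW.lintegral_incrSum_le hL hA hθ hp hvar one_pos).trans ?_
    simp only [pow_zero, mul_one]
    gcongr
    norm_num
  | succ k =>
    refine (hW.lintegral_incrSum_le hL hA hθ hp hvar two_pos).trans ?_
    -- Term `k + 1` starts from the grid with `M * 2 ^ k` steps, whose mesh is twice that of level
    -- `k + 1`; hence the 4 in a bound uniform over the levels.
    have e : 4 * (L / ((M : ℝ) * 2 ^ (k + 1))) = 2 * (L / ((M * 2 ^ k : ℕ) : ℝ)) := by
      push_cast; rw [pow_succ]; field_simp; ring
    rw [e]
    gcongr ENNReal.ofReal (4 * ?_ ^ 2 * _) * _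
    push_cast
    gcongr <;> norm_num

/-- Of `(θ - γ) * p`, an exponent 2 cancels the number of nodes and the remaining exponent, at least
2, yields `4⁻ᵏ`. One factor `2⁻ᵏ` pays for the weight `2 ^ k`, the other makes the series converge.
-/
lemma two_pow_mul_lintegral_chainTerm_le (hL : 0 < L) {A θ γ p ε : ℝ} (hA : 0 ≤ A) (hθ : 0 < θ)
    (hγ : 0 ≤ γ) (hp : 0 < p) (hpθ : 4 ≤ (θ - γ) * p)
    (hvar : ∀ x ∈ square L, ∀ y ∈ square L,
      Var[fun ω => W x ω - W y ω; P] ≤ A * dist x y ^ (2 * θ))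
    {M : ℕ} (hM : 0 < M) (hε : L / M ≤ ε) (k : ℕ) :
    2 ^ k * ∫⁻ ω, chainTerm L p M (fun z => W z ω) k ∂P
      ≤ 2⁻¹ ^ k * (ENNReal.ofReal
          (4 * L ^ 2 * A ^ (p / 2) * 4 ^ (θ * p) * L ^ ((θ - γ) * p - 2) * ε ^ (γ * p)) *
        ∫⁻ x, ‖x‖ₑ ^ p ∂(gaussianReal 0 1)) := by
  have hM' : (0 : ℝ) < M := by exact_mod_cast hM
  have hM1 : (1 : ℝ) ≤ M := by exact_mod_cast hM
  set h : ℝ := L / (M * 2 ^ k) with hh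
  have hh0 : 0 < h := by positivity
  have hhε : h ≤ ε := by
    refine le_trans ?_ hε
    rw [hh, ← div_div]
    exact div_le_self (by positivity) (one_le_pow₀ (by norm_num))
  have hε0 : 0 < ε := hh0.trans_le hhε
  have hhL : h ≤ L * 2⁻¹ ^ k := by
    rw [hh, inv_pow, ← div_eq_mul_inv, mul_comm, ← div_div]
    exact div_le_self (by positivity) hM1
  have hMh : (M : ℝ) * 2 ^ k = L / h := by rw [hh]; field_simp
  have hkey : h ^ (θ * p) ≤ h ^ 2 * (ε ^ (γ * p) * (L ^ ((θ - γ) * p - 2) * (2⁻¹ ^ k) ^ 2)) := by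
    have e1 : h ^ (θ * p) = h ^ 2 * (h ^ (γ * p) * h ^ ((θ - γ) * p - 2)) := by
      rw [← Real.rpow_natCast h 2, ← Real.rpow_add hh0, ← Real.rpow_add hh0]
      congr 1
      push_cast
      ring
    have e2 : h ^ ((θ - γ) * p - 2) ≤ L ^ ((θ - γ) * p - 2) * (2⁻¹ ^ k) ^ 2 := by
      calc h ^ ((θ - γ) * p - 2) ≤ (L * 2⁻¹ ^ k) ^ ((θ - γ) * p - 2) :=
            Real.rpow_le_rpow hh0.le hhL (by linarith)
        _ = L ^ ((θ - γ) * p - 2) * (2⁻¹ ^ k) ^ ((θ - γ) * p - 2) :=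
            Real.mul_rpow hL.le (by positivity)
        _ ≤ L ^ ((θ - γ) * p - 2) * (2⁻¹ ^ k) ^ 2 := by
            gcongr
            rw [← Real.rpow_natCast _ 2]
            refine Real.rpow_le_rpow_of_exponent_ge (by positivity)
              (pow_le_one₀ (by norm_num) (by norm_num)) ?_
            push_cast
            linarith
    rw [e1]
    gcongr
  have hreal : 4 * ((M : ℝ) * 2 ^ k) ^ 2 * (A ^ (p / 2) * (4 * h) ^ (θ * p))
      ≤ (2⁻¹ ^ k) ^ 2 *
        (4 * L ^ 2 * A ^ (p / 2) * 4 ^ (θ * p) * L ^ ((θ - γ) * p - 2) * ε ^ (γ * p)) := by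
    rw [Real.mul_rpow (by norm_num) hh0.le, hMh]
    calc 4 * (L / h) ^ 2 * (A ^ (p / 2) * (4 ^ (θ * p) * h ^ (θ * p)))
        ≤ 4 * (L / h) ^ 2 * (A ^ (p / 2) * (4 ^ (θ * p) *
          (h ^ 2 * (ε ^ (γ * p) * (L ^ ((θ - γ) * p - 2) * (2⁻¹ ^ k) ^ 2))))) := by gcongr
      _ = _ := by field_simp
  have hcast : ENNReal.ofReal ((2⁻¹ ^ k) ^ 2) = (2⁻¹ ^ k) ^ 2 := by
    rw [ENNReal.ofReal_pow (by positivity), ENNReal.ofReal_pow (by positivity),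
      ENNReal.ofReal_inv_of_pos (by norm_num)]
    simp
  calc 2 ^ k * ∫⁻ ω, chainTerm L p M (fun z => W z ω) k ∂P
      ≤ 2 ^ k * (ENNReal.ofReal ((2⁻¹ ^ k) ^ 2 *
        (4 * L ^ 2 * A ^ (p / 2) * 4 ^ (θ * p) * L ^ ((θ - γ) * p - 2) * ε ^ (γ * p))) *
        ∫⁻ x, ‖x‖ₑ ^ p ∂(gaussianReal 0 1)) := by
        gcongr
        exact (hW.lintegral_chainTerm_le hL hA hθ hp hvar hM k).trans (by gcongr)
    _ = _ := by
        rw [ENNReal.ofReal_mul (by positivity), hcast, sq, ← mul_assoc, ← mul_assoc, ← mul_assoc,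
          ← mul_pow, ENNReal.mul_inv_cancel (by norm_num) (by norm_num), one_pow, one_mul,
          mul_assoc]

lemma lintegral_pathSupNorm_rpow_le (hL : 0 < L) {A θ γ p ε : ℝ} (hA : 0 ≤ A) (hθ : 0 < θ)
    (hγ : 0 ≤ γ) (hp : 0 < p) (hpθ : 4 ≤ (θ - γ) * p)
    (hvar : ∀ x ∈ square L, ∀ y ∈ square L,
      Var[fun ω => W x ω - W y ω; P] ≤ A * dist x y ^ (2 * θ))
    {M : ℕ} (hM : 0 < M) (hε : L / M ≤ ε) :
    ∫⁻ ω, pathSupNorm L (fun z ω => W z ω - approxField L M W z ω) ω ^ p ∂P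
      ≤ (interpConst A θ γ L p * ENNReal.ofReal (ε ^ γ)) ^ p := by
  have hM' : (0 : ℝ) < M := by exact_mod_cast hM
  have hε0 : 0 < ε := lt_of_lt_of_le (by positivity) hε
  set c := (∑' k : ℕ, ((2 : ℝ≥0∞) ^ (-(1 / p))) ^ k) ^ p with hc
  have hpath : ∀ᵐ ω ∂P, pathSupNorm L (fun z ω => W z ω - approxField L M W z ω) ω ^ p
      ≤ c * ∑' k : ℕ, 2 ^ k * chainTerm L p M (fun z => W z ω) k := by
    filter_upwards [hW.continuous_paths] with ω hω
    refine le_trans (ENNReal.rpow_le_rpow ?_ hp.le) (tsum_rpow_le hp _)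
    rw [pathSupNorm, eLpNorm_exponent_top, eLpNormEssSup]
    refine essSup_le_of_ae_le _ ?_
    filter_upwards [ae_restrict_mem (measurableSet_square L)] with z hz
    exact enorm_sub_interp_le_tsum hL hp hM hω hz
  refine (lintegral_mono_ae hpath).trans ?_
  have hm : ∀ k : ℕ, AEMeasurable (fun ω => 2 ^ k * chainTerm L p M (fun z => W z ω) k) P :=
    fun k => (hW.aemeasurable_chainTerm hL p M k).const_mul _
  -- All terms are nonnegative, so expectation and sum over levels commute.
  rw [lintegral_const_mul'' _ (AEMeasurable.tsum hm), lintegral_tsum hm]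
  have hsum : ∑' k : ℕ, ∫⁻ ω, 2 ^ k * chainTerm L p M (fun z => W z ω) k ∂P
      ≤ 2 * (ENNReal.ofReal
          (4 * L ^ 2 * A ^ (p / 2) * 4 ^ (θ * p) * L ^ ((θ - γ) * p - 2) * ε ^ (γ * p)) *
        ∫⁻ x, ‖x‖ₑ ^ p ∂(gaussianReal 0 1)) := by
    calc _ ≤ ∑' k : ℕ, (2⁻¹ : ℝ≥0∞) ^ k * (ENNReal.ofReal
          (4 * L ^ 2 * A ^ (p / 2) * 4 ^ (θ * p) * L ^ ((θ - γ) * p - 2) * ε ^ (γ * p)) *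
        ∫⁻ x, ‖x‖ₑ ^ p ∂(gaussianReal 0 1)) := by
          refine ENNReal.tsum_le_tsum fun k => ?_
          rw [lintegral_const_mul'' _ (hW.aemeasurable_chainTerm hL p M k)]
          exact hW.two_pow_mul_lintegral_chainTerm_le hL hA hθ hγ hp hpθ hvar hM hε k
      _ = _ := by
          rw [ENNReal.tsum_mul_right, ENNReal.tsum_geometric, ENNReal.one_sub_inv_two, inv_inv]
  refine (mul_le_mul_right hsum c).trans (le_of_eq ?_)
  rw [interpConst, ENNReal.mul_rpow_of_nonneg _ _ hp.le, ← ENNReal.rpow_mul,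
    one_div_mul_cancel hp.ne', ENNReal.rpow_one, ← hc,
    ENNReal.ofReal_rpow_of_nonneg (by positivity) hp.le, ← Real.rpow_mul hε0.le,
    ENNReal.ofReal_mul (by positivity)]
  have h8 : ENNReal.ofReal (8 * L ^ 2 * A ^ (p / 2) * 4 ^ (θ * p) * L ^ ((θ - γ) * p - 2))
      = 2 * ENNReal.ofReal (4 * L ^ 2 * A ^ (p / 2) * 4 ^ (θ * p) * L ^ ((θ - γ) * p - 2)) := by
    rw [← ENNReal.ofReal_ofNat 2, ← ENNReal.ofReal_mul (by norm_num)]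
    congr 1
    ring
  rw [h8]
  ring

/-- Monotonicity of `L^p` norms on a probability space reduces the exponent `n` to the larger `p`;
this is where measurability of the path norm enters. -/
lemma lnLinfNorm_sub_approxField_le (hL : 0 < L) {A θ γ n p ε : ℝ} (hA : 0 ≤ A) (hθ : 0 < θ)
    (hγ : 0 ≤ γ) (hn : 0 < n) (hnp : n ≤ p) (hpθ : 4 ≤ (θ - γ) * p)
    (hvar : ∀ x ∈ square L, ∀ y ∈ square L,
      Var[fun ω => W x ω - W y ω; P] ≤ A * dist x y ^ (2 * θ))
    {M : ℕ} (hM : 0 < M) (hε : L / M ≤ ε) :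
    lnLinfNorm P n L (fun z ω => W z ω - approxField L M W z ω)
      ≤ ENNReal.ofReal ((interpConst A θ γ L p).toReal * ε ^ γ) := by
  have := hW.isProbabilityMeasure
  have hp : 0 < p := hn.trans_le hnp
  have hmono := eLpNorm'_le_eLpNorm'_of_exponent_le hn hnp P
    (aemeasurable_pathSupNorm hL hM hW).aestronglyMeasurable
  simp only [eLpNorm', enorm_eq_self] at hmono
  rw [ENNReal.ofReal_mul ENNReal.toReal_nonneg,
    ENNReal.ofReal_toReal (interpConst_ne_top _ _ _ _ hp)]
  refine hmono.trans ?_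
  rw [one_div, ENNReal.rpow_inv_le_iff hp]
  exact hW.lintegral_pathSupNorm_rpow_le hL hA hθ hγ hp hpθ hvar hM hε

end IsCenteredContinuousGRF

end GRF

/-! ### The theorem for both fields. -/

theorem lemma4p4 (α β Ce Clam γ : ℝ) (hα : 0 < α) (hβ : 0 < β) (hCe : 0 < Ce) (hClam : 0 < Clam)
    (hγ₀ : 0 ≤ γ) (hγ : γ < min 1 (β / (2 * α))) :
    ∃ C : ℝ → ℝ → ℝ, ∀ (Ω : Type*) [MeasurableSpace Ω] (P : Measure Ω) [IsProbabilityMeasure P]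
      (D K : ℝ) (W₁ W₂ : GRF.Plane → Ω → ℝ) (lam₁ lam₂ : ℕ → ℝ) (e₁ e₂ : ℕ → GRF.Plane → ℝ),
      0 < D → 0 < K →
      GRF.FieldAssumption P D K α β Ce Clam W₁ W₂ lam₁ lam₂ e₁ e₂ →
      ∀ (n ε : ℝ) (M₁ M₂ : ℕ), 1 ≤ n → 0 < ε → 1 ≤ M₁ → 1 ≤ M₂ → D / M₁ ≤ ε → K / M₂ ≤ ε →
        (AEMeasurable (GRF.pathSupNorm D (fun z ω => W₁ z ω - GRF.approxField D M₁ W₁ z ω)) P ∧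
          GRF.lnLinfNorm P n D (fun z ω => W₁ z ω - GRF.approxField D M₁ W₁ z ω)
            ≤ ENNReal.ofReal (C D n * ε ^ γ)) ∧
        (AEMeasurable (GRF.pathSupNorm K (fun z ω => W₂ z ω - GRF.approxField K M₂ W₂ z ω)) P ∧
          GRF.lnLinfNorm P n K (fun z ω => W₂ z ω - GRF.approxField K M₂ W₂ z ω)
            ≤ ENNReal.ofReal (C K n * ε ^ γ)) := by
  set θ := min 1 (β / (2 * α)) with hθdef
  have hθ0 : 0 < θ := hγ₀.trans_lt hγ
  have hθ1 : θ ≤ 1 := min_le_left _ _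
  have hθβ : 2 * α * θ ≤ β := by
    have : θ ≤ β / (2 * α) := min_le_right _ _
    rw [le_div_iff₀ (by positivity)] at this
    linarith
  -- The exponent `p = max n (4 / (θ - γ))` is the least one with `n ≤ p` and `4 ≤ (θ - γ) * p`. The
  -- constant involves neither the fields nor the grids, and the same function of side length and
  -- `n` serves both squares.
  refine ⟨fun L n =>
    (GRF.interpConst (4 * Ce ^ 2 * Clam) θ γ L (max n (4 / (θ - γ)))).toReal, ?_⟩
  intro Ω _ P _ D K W₁ W₂ lam₁ lam₂ e₁ e₂ hD hK h n ε M₁ M₂ hn _ hM₁ hM₂ hε₁ hε₂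
  have hpθ : 4 ≤ (θ - γ) * max n (4 / (θ - γ)) := by
    have h0 : 0 < θ - γ := sub_pos.2 hγ
    calc (4 : ℝ) = (θ - γ) * (4 / (θ - γ)) := by field_simp
      _ ≤ _ := by gcongr; exact le_max_right _ _
  have hl₁ := GRF.IsEigenbasis.eigenvalue_nonneg hD h.grf₁ h.eigen₁ h.bounds₁
  have hl₂ := GRF.IsEigenbasis.eigenvalue_nonneg hK h.grf₂ h.eigen₂ h.bounds₂
  have hpow : ∀ i : ℕ, (0 : ℝ) ≤ ((i : ℝ) + 1) ^ β := fun i => by positivity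
  have hle₁ : ∀ i : ℕ, lam₁ i * ((i : ℝ) + 1) ^ β ≤ (lam₁ i + lam₂ i) * ((i : ℝ) + 1) ^ β :=
    fun i => mul_le_mul_of_nonneg_right (by linarith [hl₂ i]) (hpow i)
  have hle₂ : ∀ i : ℕ, lam₂ i * ((i : ℝ) + 1) ^ β ≤ (lam₁ i + lam₂ i) * ((i : ℝ) + 1) ^ β :=
    fun i => mul_le_mul_of_nonneg_right (by linarith [hl₁ i]) (hpow i)
  have hs₁ := Summable.of_nonneg_of_le (fun i => mul_nonneg (hl₁ i) (hpow i)) hle₁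
    h.summable_eigenvalues
  have hs₂ := Summable.of_nonneg_of_le (fun i => mul_nonneg (hl₂ i) (hpow i)) hle₂
    h.summable_eigenvalues
  have hA : 0 ≤ 4 * Ce ^ 2 * Clam := by positivity
  have hn0 : 0 < n := by linarith
  refine ⟨⟨GRF.aemeasurable_pathSupNorm hD hM₁ h.grf₁, ?_⟩,
    GRF.aemeasurable_pathSupNorm hK hM₂ h.grf₂, ?_⟩
  · exact h.grf₁.lnLinfNorm_sub_approxField_le hD hA hθ0 hγ₀ hn0 (le_max_left _ _) hpθ
      (fun x hx y hy => GRF.IsEigenbasis.variance_increment_le hD h.grf₁ h.eigen₁ h.bounds₁ hCe hl₁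
        hβ.le hs₁ ((hs₁.tsum_le_tsum hle₁ h.summable_eigenvalues).trans h.sum_eigenvalues)
        hθ0 hθ1 hθβ hx hy) hM₁ hε₁
  · exact h.grf₂.lnLinfNorm_sub_approxField_le hK hA hθ0 hγ₀ hn0 (le_max_left _ _) hpθ
      (fun x hx y hy => GRF.IsEigenbasis.variance_increment_le hK h.grf₂ h.eigen₂ h.bounds₂ hCe hl₂
        hβ.le hs₂ ((hs₂.tsum_le_tsum hle₂ h.summable_eigenvalues).trans h.sum_eigenvalues)
        hθ0 hθ1 hθβ hx hy) hM₂ hε₂
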